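/- Let $(M,\bar g,I,J,K)$ be a hyperk\"ahler 4-manifold: a smooth 4-manifold with a Riemannian metric $\bar g$ and almost complex structures $I,J,K$ that are $\bar g$-orthogonal, parallel for the Levi-Civita connection $\overline\nabla$ of $\bar g$, and satisfy $I^2=J^2=K^2=-1$, $IJ=K$. Put $\bar\omega_1=\bar g(I\cdot,\cdot)$, $\bar\omega_2=\bar g(J\cdot,\cdot)$, $\bar\omega_3=\bar g(K\cdot,\cdot)$. Let $S$ be a smooth surface with a volume form $\rho$ (a nowhere vanishing smooth 2-form, which also orients $S$). For an immersion $f:S\to M$ let $N_a=f^*\bar\omega_a/\rho$ and let $\xi_a$ be the Hamiltonian vector field on $S$ with $\rho(\xi_a,\cdot)=dN_a$, $a=1,2,3$. Let $g=f^*\bar g$ be the induced metric, with Levi-Civita connection $\nabla$ and Laplacian $\triangle=g^{ij}\nabla_i\nabla_j$, let $d\mu$ be its area form for the orientation given by $\rho$, and let $\lambda=d\mu/\rho>0$. For an orthonormal frame $\{e_3,e_4\}$ of the normal bundle write $h_{\alpha ij}=\bar g(e_\alpha,\overline\nabla_{\partial_i}\partial_j)$, $H_\alpha=g^{ij}h_{\alpha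 ij}$, and let $H=H_\alpha e_\alpha$ be the mean curvature vector, $|H|^2=\bar g(H,H)$ (repeated indices are summed). Let $f_t$, with $t$ in a nondegenerate interval $\tau$ with least element $0$ (such as $[0,T]$, $[0,T)$ or $[0,\infty)$), be a smooth family of immersions $S\to M$ that solves the H-flow $$\frac{\partial f}{\partial t}=I f_*(\xi_1)+J f_*(\xi_2)+K f_*(\xi_3).$$ Then for all $t\in\tau$, at every point of $S$ (time derivatives being one-sided at an endpoint of $\tau$): (i) $\displaystyle\frac{\partial}{\partial t}g_{kl}=\nabla_k\nabla_l(\lambda^2)-2\lambda^2H_\alpha h_{\alpha kl}$; (ii) $\displaystyle\frac{\partial}{\partial t}d\mu=\left(\triangle\Big(\frac{\lambda^2}{2}\Big)-\lambda^2|H|^2\right)d\mu$; (iii) $\displaystyle\frac{\partial}{\partial t}\lambda^2=\lambda^2\triangle\lambda^2-2(\lambda^2)^2|H|^2$. If moreover $S$ is compact, then $\lambda(x,t)\le\sup_S\lambda|_{t=0}$ for all $t\in\tau$ and $x\in S$. -/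

import Mathlib

open Set Manifold Bundle
open scoped ContDiff

noncomputable section

namespace HFlow

/-- The model space `ℝⁿ`. For a manifold `N` modelled on it, every tangent space `T_qN` is by
definition a copy of `ℝⁿ`, the identification being the one given by the preferred chart at `q`;
so `basisVec n i`, seen in `T_qN`, is the `i`-th coordinate vector `∂_i` of that chart at `q`. -/
abbrev Euc (n : ℕ) : Type := EuclideanSpace ℝ (Fin n)

/-- The `i`-th standard basis vector. -/
def basisVec (n : ℕ) (i : Fin n) : Euc n := EuclideanSpace.single i 1

/-- The matrix `B_{ij} = B(∂_i, ∂_j)` of a bilinear form. -/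
def gram {n : ℕ} (B : Euc n →L[ℝ] Euc n →L[ℝ] ℝ) : Matrix (Fin n) (Fin n) ℝ :=
  Matrix.of fun i j => B (basisVec n i) (basisVec n j)

/-- The trace `B^{ij} T(∂_i, ∂_j)` of a bilinear `T` with respect to the inner product `B`. -/
def metricTrace {n : ℕ} {V : Type*} [AddCommGroup V] [Module ℝ V]
    (B : Euc n →L[ℝ] Euc n →L[ℝ] ℝ) (T : Euc n → Euc n → V) : V :=
  ∑ i, ∑ j, ((gram B)⁻¹ i j) • T (basisVec n i) (basisVec n j)

/-- The pullback `(v,w) ↦ B(Dv, Dw)` of a bilinear form under a linear map. -/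
def pullForm {m n : ℕ} (B : Euc m →L[ℝ] Euc m →L[ℝ] ℝ) (D : Euc n →L[ℝ] Euc m) :
    Euc n →L[ℝ] Euc n →L[ℝ] ℝ :=
  B.bilinearComp D D

section Connection

variable {n : ℕ} {N : Type*} [TopologicalSpace N] [ChartedSpace (Euc n) N]
  [IsManifold (𝓡 n) ∞ N]

/-- A bilinear form in the chart at `q`: at the point `y` of the chart domain this has components
`b_{ij}(y) = b(∂_i, ∂_j)`. Here `symmL` of the trivialization of the tangent bundle at `q` is the
differential of the inverse of the chart at `q`. -/
def chartForm (b : ∀ x : N, TangentSpace (𝓡 n) x →L[ℝ] TangentSpace (𝓡 n) x →L[ℝ] ℝ)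
    (q : N) (y : Euc n) : Euc n →L[ℝ] Euc n →L[ℝ] ℝ :=
  let x := (extChartAt (𝓡 n) q).symm y
  let D := (trivializationAt (Euc n) (TangentSpace (𝓡 n)) q).symmL ℝ x
  pullForm (b x) D

/-- A field of endomorphisms of the tangent spaces in the chart at `q`. -/
def chartEnd (A : ∀ x : N, TangentSpace (𝓡 n) x →L[ℝ] TangentSpace (𝓡 n) x)
    (q : N) (y : Euc n) : Euc n →L[ℝ] Euc n :=
  let x := (extChartAt (𝓡 n) q).symm y
  let e := trivializationAt (Euc n) (TangentSpace (𝓡 n)) q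
  (e.continuousLinearMapAt ℝ x).comp ((A x).comp (e.symmL ℝ x))

/-- Christoffel symbols of the first kind of the metric `g`, at `q` in the chart at `q`:
`½ (∂_v g(w,z) + ∂_w g(v,z) - ∂_z g(v,w))`. -/
def christoffelLow (g : ∀ x : N, TangentSpace (𝓡 n) x →L[ℝ] TangentSpace (𝓡 n) x →L[ℝ] ℝ)
    (q : N) (v w z : Euc n) : ℝ :=
  let dG := fderiv ℝ (chartForm g q) (extChartAt (𝓡 n) q q)
  (1 / 2) * (dG v w z + dG w v z - dG z v w)

/-- Christoffel symbols (of the second kind) of the Levi-Civita connection of `g`, at `q` in the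
chart at `q`: the vector `Γ(v,w) = g^{ij} Γ_{i}(v,w) ∂_j`. -/
def christoffel (g : ∀ x : N, TangentSpace (𝓡 n) x →L[ℝ] TangentSpace (𝓡 n) x →L[ℝ] ℝ)
    (q : N) (v w : Euc n) : Euc n :=
  metricTrace (g q) fun a b => christoffelLow g q v w a • b

/-- The covariant derivative `(∇_v A) w` at `q` of a field of endomorphisms, for the Levi-Civita
connection of `g`. -/
def covDerivEnd (g : ∀ x : N, TangentSpace (𝓡 n) x →L[ℝ] TangentSpace (𝓡 n) x →L[ℝ] ℝ)
    (A : ∀ x : N, TangentSpace (𝓡 n) x →L[ℝ] TangentSpace (𝓡 n) x)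
    (q : N) (v w : Euc n) : Euc n :=
  let Aq : Euc n →L[ℝ] Euc n := A q
  fderiv ℝ (chartEnd A q) (extChartAt (𝓡 n) q q) v w
    + christoffel g q v (Aq w) - Aq (christoffel g q v w)

/-- The Hessian `∇_v ∇_w u` at `p` of a function, for the Levi-Civita connection of `g`:
`∂_v ∂_w u - du(Γ(v,w))` in the chart at `p`. -/
def hess (g : ∀ x : N, TangentSpace (𝓡 n) x →L[ℝ] TangentSpace (𝓡 n) x →L[ℝ] ℝ)
    (u : N → ℝ) (p : N) (v w : Euc n) : ℝ :=
  let U := u ∘ (extChartAt (𝓡 n) p).symm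
  let y := extChartAt (𝓡 n) p p
  fderiv ℝ (fderiv ℝ U) y v w - fderiv ℝ U y (christoffel g p v w)

/-- The Laplace-Beltrami operator `Δu = g^{ij} ∇_i ∇_j u`. -/
def laplacian (g : ∀ x : N, TangentSpace (𝓡 n) x →L[ℝ] TangentSpace (𝓡 n) x →L[ℝ] ℝ)
    (u : N → ℝ) (p : N) : ℝ :=
  metricTrace (g p) (hess g u p)

end Connection

/-- A hyperkähler structure on a 4-manifold: a smooth Riemannian metric and three smooth almost
complex structures `I = cplx 0`, `J = cplx 1`, `K = cplx 2` satisfying the quaternion relations,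
orthogonal for the metric and parallel for its Levi-Civita connection. -/
structure HyperKahler (M : Type*) [TopologicalSpace M] [ChartedSpace (Euc 4) M]
    [IsManifold (𝓡 4) ∞ M] where
  /-- the metric -/
  metric : ContMDiffRiemannianMetric (𝓡 4) ∞ (Euc 4) (fun x : M => TangentSpace (𝓡 4) x)
  /-- the complex structures `I`, `J`, `K` -/
  cplx : Fin 3 → ∀ x : M, TangentSpace (𝓡 4) x →L[ℝ] TangentSpace (𝓡 4) x
  smooth : ∀ a, ContMDiff (𝓡 4) ((𝓡 4).prod 𝓘(ℝ, Euc 4 →L[ℝ] Euc 4)) ∞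
    (fun x => TotalSpace.mk' (Euc 4 →L[ℝ] Euc 4)
      (E := fun x : M => TangentSpace (𝓡 4) x →L[ℝ] TangentSpace (𝓡 4) x) x (cplx a x))
  sq : ∀ a x v, cplx a x (cplx a x v) = -v
  quat : ∀ x v, cplx 0 x (cplx 1 x v) = cplx 2 x v
  orthogonal : ∀ a x v w, metric.inner x (cplx a x v) (cplx a x w) = metric.inner x v w
  parallel : ∀ a x v w, covDerivEnd metric.inner (cplx a) x v w = 0

/-- A volume (area) form on a surface: a smooth nowhere vanishing 2-form. It also fixes the
orientation of the surface. -/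
structure AreaForm (S : Type*) [TopologicalSpace S] [ChartedSpace (Euc 2) S]
    [IsManifold (𝓡 2) ∞ S] where
  /-- the 2-form -/
  form : ∀ x : S, TangentSpace (𝓡 2) x →L[ℝ] TangentSpace (𝓡 2) x →L[ℝ] ℝ
  alternating : ∀ x v, form x v v = 0
  nonvanishing : ∀ x, form x ≠ 0
  smooth : ContMDiff (𝓡 2) ((𝓡 2).prod 𝓘(ℝ, Euc 2 →L[ℝ] Euc 2 →L[ℝ] ℝ)) ∞
    (fun x => TotalSpace.mk' (Euc 2 →L[ℝ] Euc 2 →L[ℝ] ℝ)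
      (E := fun x : S => TangentSpace (𝓡 2) x →L[ℝ] TangentSpace (𝓡 2) x →L[ℝ] ℝ) x (form x))

/-- The function `β / ρ`, for 2-forms `β` and `ρ` on a two-dimensional space with `ρ ≠ 0`. -/
def formRatio (β ρ : Euc 2 → Euc 2 → ℝ) : ℝ :=
  β (basisVec 2 0) (basisVec 2 1) / ρ (basisVec 2 0) (basisVec 2 1)

section Immersed

variable {S M : Type*} [TopologicalSpace S] [ChartedSpace (Euc 2) S] [IsManifold (𝓡 2) ∞ S]
  [TopologicalSpace M] [ChartedSpace (Euc 4) M] [IsManifold (𝓡 4) ∞ M]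

/-- The Kähler forms `ω_a(v,w) = g(J_a v, w)`, for `J_a = I, J, K`. -/
def kahlerForm (𝓗 : HyperKahler M) (a : Fin 3) (y : M) (v w : TangentSpace (𝓡 4) y) : ℝ :=
  𝓗.metric.inner y (𝓗.cplx a y v) w

/-- The functions `N_a = f^*ω_a / ρ`. -/
def momentFn (𝓗 : HyperKahler M) (ρ : AreaForm S) (f : S → M) (a : Fin 3) (x : S) : ℝ :=
  formRatio
    (fun v w => kahlerForm 𝓗 a (f x) (mfderiv (𝓡 2) (𝓡 4) f x v) (mfderiv (𝓡 2) (𝓡 4) f x w))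
    (fun v w => ρ.form x v w)

/-- The induced metric `f^*g`. -/
def inducedMetric (𝓗 : HyperKahler M) (f : S → M) (x : S) :
    TangentSpace (𝓡 2) x →L[ℝ] TangentSpace (𝓡 2) x →L[ℝ] ℝ :=
  pullForm (𝓗.metric.inner (f x)) (mfderiv (𝓡 2) (𝓡 4) f x)

/-- The area form `dμ` of the induced metric, for the orientation given by `ρ`: on `(v,w)` it is the
area of the parallelogram spanned by `v` and `w`, with the sign of `ρ(v,w)`. -/
def inducedArea (𝓗 : HyperKahler M) (ρ : AreaForm S) (f : S → M) (x : S)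
    (v w : TangentSpace (𝓡 2) x) : ℝ :=
  (SignType.sign (ρ.form x v w) : ℝ) *
    Real.sqrt (inducedMetric 𝓗 f x v v * inducedMetric 𝓗 f x w w - inducedMetric 𝓗 f x v w ^ 2)

/-- The function `λ = dμ / ρ`. -/
def lam (𝓗 : HyperKahler M) (ρ : AreaForm S) (f : S → M) (x : S) : ℝ :=
  formRatio (fun v w => inducedArea 𝓗 ρ f x v w) (fun v w => ρ.form x v w)

/-- The orthogonal projection of a tangent vector of `M` at `f x` to the normal space of the
immersion `f` at `x`. -/
def normalPart (𝓗 : HyperKahler M) (f : S → M) (x : S) (V : TangentSpace (𝓡 4) (f x)) :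
    TangentSpace (𝓡 4) (f x) :=
  V - metricTrace (inducedMetric 𝓗 f x) fun a b =>
    𝓗.metric.inner (f x) V (mfderiv (𝓡 2) (𝓡 4) f x a) • mfderiv (𝓡 2) (𝓡 4) f x b

/-- The derivative along `f`, for the Levi-Civita connection of `M`, of the coordinate vector
fields: for `v = ∂_i`, `w = ∂_j` in the chart at `x` this is the derivative of `f_*∂_j` in the
direction `∂_i`, whose components in the chart at `f x` are
`∂_i ∂_j f^A + Γ^A_{BC} ∂_i f^B ∂_j f^C`. -/
def covDerivAlong (𝓗 : HyperKahler M) (f : S → M) (x : S) (v w : TangentSpace (𝓡 2) x) :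
    TangentSpace (𝓡 4) (f x) :=
  (fderiv ℝ (fderiv ℝ (writtenInExtChartAt (𝓡 2) (𝓡 4) x f)) (extChartAt (𝓡 2) x x) v w : Euc 4)
    + christoffel 𝓗.metric.inner (f x) (mfderiv (𝓡 2) (𝓡 4) f x v) (mfderiv (𝓡 2) (𝓡 4) f x w)

/-- The second fundamental form `A(v,w)`, with values in the normal bundle. -/
def secondFF (𝓗 : HyperKahler M) (f : S → M) (x : S) (v w : TangentSpace (𝓡 2) x) :
    TangentSpace (𝓡 4) (f x) :=
  normalPart 𝓗 f x (covDerivAlong 𝓗 f x v w)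

/-- The mean curvature vector `H = g^{ij} A(∂_i, ∂_j)`. -/
def meanCurv (𝓗 : HyperKahler M) (f : S → M) (x : S) : TangentSpace (𝓡 4) (f x) :=
  metricTrace (inducedMetric 𝓗 f x) fun a b => secondFF 𝓗 f x a b

/-- `|H|²`. -/
def meanCurvSq (𝓗 : HyperKahler M) (f : S → M) (x : S) : ℝ :=
  𝓗.metric.inner (f x) (meanCurv 𝓗 f x) (meanCurv 𝓗 f x)

/-- `e` is an orthonormal basis of the normal space of the immersion `f` at `x`. -/
def IsNormalFrame (𝓗 : HyperKahler M) (f : S → M) (x : S)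
    (e : Fin 2 → TangentSpace (𝓡 4) (f x)) : Prop :=
  (∀ α β, 𝓗.metric.inner (f x) (e α) (e β) = if α = β then 1 else 0) ∧
  (∀ α v, 𝓗.metric.inner (f x) (e α) (mfderiv (𝓡 2) (𝓡 4) f x v) = 0)

/-- The family `f t`, for `t` in the time interval `τ`, is a smooth solution, through immersions, of
`∂f/∂t = I f_*ξ₁ + J f_*ξ₂ + K f_*ξ₃`, where `ξ_a` is the Hamiltonian vector field of `N_a`, that is
`ρ(ξ_a, ·) = dN_a`. At an endpoint of `τ` that belongs to `τ` the time derivative is one-sided. -/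
structure IsHFlow (𝓗 : HyperKahler M) (ρ : AreaForm S) (τ : Set ℝ) (f : ℝ → S → M) : Prop where
  smooth : ContMDiffOn (𝓘(ℝ, ℝ).prod (𝓡 2)) (𝓡 4) ∞ (fun z : ℝ × S => f z.1 z.2) (τ ×ˢ univ)
  immersion : ∀ t ∈ τ, ∀ x, Function.Injective (mfderiv (𝓡 2) (𝓡 4) (f t) x)
  flow : ∀ t ∈ τ, ∀ x, ∃ ξ : Fin 3 → TangentSpace (𝓡 2) x,
    (∀ a v, ρ.form x (ξ a) v = mfderiv (𝓡 2) 𝓘(ℝ, ℝ) (momentFn 𝓗 ρ (f t) a) x v) ∧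
    HasMFDerivWithinAt 𝓘(ℝ, ℝ) (𝓡 4) (fun s => f s x) τ t
      (ContinuousLinearMap.toSpanSingleton ℝ
        (∑ a, 𝓗.cplx a (f t x) (mfderiv (𝓡 2) (𝓡 4) (f t) x (ξ a))))

end Immersed

end HFlow

end

/-!
Parseval's identity for the orthonormal frame `v, I v, J v, K v` of a tangent space of `M` gives
`λ² = N₁² + N₂² + N₃²` and identifies the velocity `I f_*ξ₁ + J f_*ξ₂ + K f_*ξ₃` of the flow: its
tangential part is `½ ∇λ²` and its normal part is `λ² H`. The normal part rests on
`∇̄I = ∇̄J = ∇̄K = 0`, which lets one differentiate `N_a` through `f` alone. The first variation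
formula then gives (i). Tracing (i) yields (ii) and, as `ρ` is fixed, (iii); at a spatial maximum of
`λ²` the right-hand side of (iii) is nonpositive, whence the bound on a compact `S`.
-/

noncomputable section

namespace HFlow

/-! ### Linear algebra -/

/-- The bilinear forms on `ℝⁿ`. -/
abbrev BilinForm (n : ℕ) : Type := Euc n →L[ℝ] Euc n →L[ℝ] ℝ

lemma eq_sum_basisVec {n : ℕ} (v : Euc n) : v = ∑ i, v i • basisVec n i := by
  ext j
  simp [basisVec, Finset.sum_apply, Pi.single_apply]

lemma eq_smul_basisVec (v : Euc 2) : v = v 0 • basisVec 2 0 + v 1 • basisVec 2 1 := by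
  rw [← Fin.sum_univ_two fun i => v i • basisVec 2 i, ← eq_sum_basisVec]

/-- `B` is an inner product: a symmetric, positive definite bilinear form. -/
structure IsInner {n : ℕ} (B : BilinForm n) : Prop where
  symm : ∀ v w, B v w = B w v
  pos : ∀ v, v ≠ 0 → 0 < B v v

namespace IsInner

variable {m n : ℕ} {B : BilinForm n}

lemma nonneg (h : IsInner B) (v : Euc n) : 0 ≤ B v v := by
  rcases eq_or_ne v 0 with rfl | hv
  · simp
  · exact (h.pos v hv).le

lemma ext_inner (h : IsInner B) {v w : Euc n} (hvw : ∀ z, B z v = B z w) : v = w := by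
  by_contra hne
  refine (h.pos (v - w) (sub_ne_zero.2 hne)).ne' ?_
  rw [map_sub, hvw, sub_self]

lemma eq_zero_of_orthogonal (h : IsInner B) {s : Set (Euc n)} (hs : Submodule.span ℝ s = ⊤)
    {z : Euc n} (hz : ∀ v ∈ s, B v z = 0) : z = 0 := by
  have hflip : (B.flip z : Euc n →ₗ[ℝ] ℝ) = 0 := LinearMap.ext_on hs hz
  exact h.ext_inner fun w => by simpa using LinearMap.congr_fun hflip w

lemma sum_mul_of_orthogonal (h : IsInner B) {b : Fin n → Euc n} {r : ℝ} (hr : r ≠ 0)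
    (hb : ∀ i j, B (b i) (b j) = if i = j then r else 0) (y w : Euc n) :
    ∑ i, B (b i) y * B (b i) w = r * B y w := by
  have hli : LinearIndependent ℝ b := by
    rw [Fintype.linearIndependent_iff]
    intro c hc i
    have hi : B (b i) (∑ j, c j • b j) = c i * r := by simp [hb]
    rw [hc, map_zero] at hi
    simpa [hr] using hi.symm
  have hexp : r • y - ∑ j, B (b j) y • b j = 0 := by
    refine h.eq_zero_of_orthogonal (hli.span_eq_top_of_card_eq_finrank' (by simp)) ?_
    rintro _ ⟨i, rfl⟩
    simp [hb, mul_comm]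
  rw [← smul_eq_mul, ← smul_apply, ← map_smul, sub_eq_zero.1 hexp]
  simp

lemma sum_inner_normalFrame (h : IsInner B) {k : ℕ} {D : Euc m →L[ℝ] Euc n}
    (hD : Function.Injective D) (hmk : m + k = n) {e : Fin k → Euc n}
    (he : ∀ α β, B (e α) (e β) = if α = β then 1 else 0) (heD : ∀ α v, B (e α) (D v) = 0)
    {y : Euc n} (hy : ∀ v, B (D v) y = 0) (w : Euc n) :
    ∑ α, B (e α) y * B (e α) w = B y w := by
  let Φ : (Euc m × (Fin k → ℝ)) →ₗ[ℝ] Euc n := (D : Euc m →ₗ[ℝ] Euc n).coprod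
    (Fintype.linearCombination ℝ e)
  have hΦ : ∀ p, Φ p = D p.1 + ∑ α, p.2 α • e α := fun _ => rfl
  have hinj : Function.Injective Φ := by
    rw [injective_iff_map_eq_zero]
    rintro ⟨v, c⟩ hvc
    have hc : c = 0 := by
      funext α
      have hα := congrArg (B (e α)) hvc
      simpa [hΦ, he, heD] using hα
    have hv : D v = D 0 := by simpa [hΦ, hc] using hvc
    rw [hD hv, hc]
    rfl
  have hsurj : Function.Surjective Φ :=
    (LinearMap.injective_iff_surjective_of_finrank_eq_finrank (by simp [hmk])).1 hinj
  have hexp : y - ∑ α, B (e α) y • e α = 0 := by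
    refine h.eq_zero_of_orthogonal Submodule.span_univ fun v _ => ?_
    obtain ⟨p, rfl⟩ := hsurj v
    simp [hΦ, hy, he, h.symm (D _) (e _), heD]
  rw [sub_eq_zero.1 hexp]
  simp [he]

lemma pull (h : IsInner B) {D : Euc m →L[ℝ] Euc n} (hD : Function.Injective D) :
    IsInner (pullForm B D) where
  symm v w := h.symm (D v) (D w)
  pos v hv := h.pos (D v) ((map_ne_zero_iff D hD).2 hv)

lemma gram_posDef (h : IsInner B) : (gram B).PosDef := by
  refine Matrix.PosDef.of_dotProduct_mulVec_pos (Matrix.IsHermitian.ext fun i j => ?_)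
    fun x hx => ?_
  · exact h.symm _ _
  · have hpos := h.pos (WithLp.toLp 2 x) (by simpa using hx)
    rw [eq_sum_basisVec (WithLp.toLp 2 x)] at hpos
    simpa [dotProduct, Matrix.mulVec, gram, Finset.mul_sum, mul_left_comm, mul_comm, h.symm]
      using hpos

lemma det_gram_pos (h : IsInner B) : 0 < (gram B).det := h.gram_posDef.det_pos

lemma inner_metricTrace_smul (h : IsInner B) (L : Euc n →ₗ[ℝ] ℝ) (z : Euc n) :
    B (metricTrace B fun a b => L a • b) z = L z := by
  have hinv : ∀ i k, ∑ j, (gram B)⁻¹ i j * B (basisVec n j) (basisVec n k)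
      = if i = k then 1 else 0 := fun i k => by
    have hik := congrFun (congrFun (Matrix.nonsing_inv_mul (gram B) h.det_gram_pos.ne'.isUnit) i) k
    simpa [Matrix.mul_apply, gram, Matrix.one_apply] using hik
  have hbasis : ∀ k, B (metricTrace B fun a b => L a • b) (basisVec n k) = L (basisVec n k) := by
    intro k
    calc B (metricTrace B fun a b => L a • b) (basisVec n k)
        = ∑ i, L (basisVec n i) * ∑ j, (gram B)⁻¹ i j * B (basisVec n j) (basisVec n k) := by
          simp [metricTrace, Finset.mul_sum, mul_left_comm]
      _ = L (basisVec n k) := by simp [hinv]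
  rw [eq_sum_basisVec z]
  simp [hbasis]

lemma metricTrace_nonpos (h : IsInner B) {A : BilinForm n} (hA : ∀ v, A v v ≤ 0) :
    metricTrace B (fun v w => A v w) ≤ 0 := by
  obtain ⟨k, c, hc⟩ := Matrix.posSemidef_iff_eq_sum_vecMulVec.1 h.gram_posDef.posSemidef.inv
  have hsum : metricTrace B (fun v w => A v w)
      = ∑ l, A (∑ i, c l i • basisVec n i) (∑ i, c l i • basisVec n i) := by
    simp only [metricTrace, hc, Matrix.sum_apply, Matrix.vecMulVec_apply, map_sum, map_smul,
      sum_apply, smul_apply, smul_eq_mul, Finset.sum_mul, Finset.mul_sum, star_trivial]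
    rw [Finset.sum_comm_cycle]
    refine Finset.sum_congr rfl fun l _ => ?_
    rw [Finset.sum_comm]
    exact Finset.sum_congr rfl fun j _ => Finset.sum_congr rfl fun i _ => by ring
  exact hsum ▸ Finset.sum_nonpos fun l _ => hA _

end IsInner

lemma map_metricTrace {n : ℕ} {V W : Type*} [AddCommGroup V] [Module ℝ V] [AddCommGroup W]
    [Module ℝ W] (L : V →ₗ[ℝ] W) (B : BilinForm n) (T : Euc n → Euc n → V) :
    L (metricTrace B T) = metricTrace B fun a b => L (T a b) := by
  simp [metricTrace]

/-- The projection of `X` to the `B`-orthogonal complement of the range of `D`. -/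
def normalProj {m n : ℕ} (B : BilinForm n) (D : Euc m →L[ℝ] Euc n) (X : Euc n) : Euc n :=
  X - metricTrace (pullForm B D) fun a b => B X (D a) • D b

lemma IsInner.normalProj_eq {m n : ℕ} {B : BilinForm n} {D : Euc m →L[ℝ] Euc n} (h : IsInner B)
    (hD : Function.Injective D) {X : Euc n} {u : Euc m} (hu : ∀ z, B (D u) (D z) = B X (D z)) :
    normalProj B D X = X - D u := by
  have hpull := h.pull hD
  have htr : metricTrace (pullForm B D) (fun a b => B X (D a) • b) = u :=
    hpull.ext_inner fun z => by
      rw [hpull.symm, hpull.symm z]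
      exact (hpull.inner_metricTrace_smul ((B X).comp D : Euc m →ₗ[ℝ] ℝ) z).trans (hu z).symm
  have hmap := map_metricTrace (D : Euc m →ₗ[ℝ] Euc n) (pullForm B D) fun a b => B X (D a) • b
  simp only [ContinuousLinearMap.coe_coe, map_smul, htr] at hmap
  rw [normalProj, hmap]

lemma IsInner.inner_normalProj {m n : ℕ} {B : BilinForm n} {D : Euc m →L[ℝ] Euc n}
    (h : IsInner B) (hD : Function.Injective D) (X : Euc n) (z : Euc m) :
    B (normalProj B D X) (D z) = 0 := by
  have hpull := h.pull hD
  have hu : ∀ z, B (D (metricTrace (pullForm B D) fun a b => B X (D a) • b)) (D z) = B X (D z) :=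
    hpull.inner_metricTrace_smul ((B X).comp D : Euc m →ₗ[ℝ] ℝ)
  rw [h.normalProj_eq hD hu, map_sub, sub_apply, hu, sub_self]

/-- The determinant `v⁰w¹ - v¹w⁰`. -/
def wedge (v w : Euc 2) : ℝ := v 0 * w 1 - v 1 * w 0

lemma smul_eq_of_wedge {r : ℝ} {η : Euc 2} {α : Euc 2 →L[ℝ] ℝ}
    (hη : ∀ v, r * wedge η v = α v) :
    r • η = α (basisVec 2 1) • basisVec 2 0 - α (basisVec 2 0) • basisVec 2 1 := by
  rw [← hη, ← hη]
  ext i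
  fin_cases i <;> simp [wedge, basisVec]

lemma alternating_apply {β : BilinForm 2} (hβ : ∀ v, β v v = 0) (v w : Euc 2) :
    β v w = wedge v w * β (basisVec 2 0) (basisVec 2 1) := by
  have hswap : β (basisVec 2 1) (basisVec 2 0) = -β (basisVec 2 0) (basisVec 2 1) := by
    have hadd := hβ (basisVec 2 0 + basisVec 2 1)
    simp only [map_add, add_apply, hβ, zero_add, add_zero] at hadd
    linarith
  conv_lhs => rw [eq_smul_basisVec v, eq_smul_basisVec w]
  simp only [map_add, map_smul, add_apply, smul_apply, smul_eq_mul, hβ, hswap, wedge]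
  ring

lemma wedge_map (D : Euc 2 →L[ℝ] Euc 2) (v w : Euc 2) :
    wedge (D v) (D w) = wedge v w * wedge (D (basisVec 2 0)) (D (basisVec 2 1)) := by
  conv_lhs => rw [eq_smul_basisVec v, eq_smul_basisVec w]
  simp only [map_add, map_smul, wedge, PiLp.add_apply, PiLp.smul_apply, smul_eq_mul]
  ring

lemma wedge_ne_zero {D : Euc 2 →L[ℝ] Euc 2} (hD : Function.Injective D) :
    wedge (D (basisVec 2 0)) (D (basisVec 2 1)) ≠ 0 := by
  have hsurj : Function.Surjective D :=
    (LinearMap.injective_iff_surjective (f := (D : Euc 2 →ₗ[ℝ] Euc 2))).1 hD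
  obtain ⟨v, hv⟩ := hsurj (basisVec 2 0)
  obtain ⟨w, hw⟩ := hsurj (basisVec 2 1)
  have hone : wedge v w * wedge (D (basisVec 2 0)) (D (basisVec 2 1)) = 1 := by
    rw [← wedge_map, hv, hw]
    simp [wedge, basisVec]
  exact right_ne_zero_of_mul_eq_one hone

section Gram

variable {B : BilinForm 2}

lemma IsInner.det_gram_eq (h : IsInner B) : (gram B).det
    = B (basisVec 2 0) (basisVec 2 0) * B (basisVec 2 1) (basisVec 2 1)
      - B (basisVec 2 0) (basisVec 2 1) ^ 2 := by
  simp only [Matrix.det_fin_two, gram, Matrix.of_apply, h.symm (basisVec 2 1) (basisVec 2 0), sq]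

lemma IsInner.gram_apply_eq (h : IsInner B) (v w : Euc 2) :
    B v v * B w w - B v w ^ 2 = wedge v w ^ 2 * (gram B).det := by
  rw [h.det_gram_eq]
  conv_lhs => rw [eq_smul_basisVec v, eq_smul_basisVec w]
  simp only [map_add, map_smul, add_apply, smul_apply, smul_eq_mul, wedge,
    h.symm (basisVec 2 1) (basisVec 2 0)]
  ring

lemma IsInner.det_gram_smul_metricTrace (h : IsInner B) {V : Type*} [AddCommGroup V] [Module ℝ V]
    (T : Euc 2 → Euc 2 → V) :
    (gram B).det • metricTrace B T =
      B (basisVec 2 1) (basisVec 2 1) • T (basisVec 2 0) (basisVec 2 0)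
        - B (basisVec 2 0) (basisVec 2 1) • T (basisVec 2 0) (basisVec 2 1)
        - B (basisVec 2 0) (basisVec 2 1) • T (basisVec 2 1) (basisVec 2 0)
        + B (basisVec 2 0) (basisVec 2 0) • T (basisVec 2 1) (basisVec 2 1) := by
  refine ((inv_smul_eq_iff₀ h.det_gram_pos.ne').1 ?_).symm
  simp only [metricTrace, Fin.sum_univ_two, Matrix.inv_def, Matrix.adjugate_fin_two,
    Ring.inverse_eq_inv', Matrix.smul_apply, gram, Matrix.of_apply, Matrix.cons_val',
    Matrix.cons_val_zero, Matrix.cons_val_one, Matrix.cons_val_fin_one, smul_eq_mul,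
    h.symm (basisVec 2 1) (basisVec 2 0)]
  module

end Gram

lemma hasDerivWithinAt_det_gram {B : ℝ → BilinForm 2} {T : Euc 2 → Euc 2 → ℝ} {τ : Set ℝ} {t : ℝ}
    (hB : IsInner (B t)) (hT : ∀ v w, HasDerivWithinAt (fun s => B s v w) (T v w) τ t) :
    HasDerivWithinAt (fun s => (gram (B s)).det) ((gram (B t)).det * metricTrace (B t) T) τ t := by
  simp only [Matrix.det_fin_two, gram, Matrix.of_apply]
  refine (((hT _ _).mul (hT _ _)).sub ((hT _ _).mul (hT _ _))).congr_deriv ?_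
  have htr := hB.det_gram_smul_metricTrace T
  simp only [Matrix.det_fin_two, gram, Matrix.of_apply, smul_eq_mul] at htr
  rw [htr, hB.symm (basisVec 2 1) (basisVec 2 0)]
  ring

/-- `J 0, J 1, J 2` are almost complex structures `I, J, K` on `ℝ⁴` with `IJ = K`, orthogonal for
the inner product `G`. -/
structure IsQuaternionic (G : BilinForm 4) (J : Fin 3 → Euc 4 →L[ℝ] Euc 4) : Prop
    extends IsInner G where
  sq : ∀ a v, J a (J a v) = -v
  quat : ∀ v, J 0 (J 1 v) = J 2 v
  orth : ∀ a v w, G (J a v) (J a w) = G v w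

namespace IsQuaternionic

variable {G : BilinForm 4} {J : Fin 3 → Euc 4 →L[ℝ] Euc 4}

lemma skew (h : IsQuaternionic G J) (a : Fin 3) (v w : Euc 4) : G (J a v) w = -G (J a w) v := by
  rw [← h.orth a (J a v) w, h.sq, h.symm (J a w), map_neg, neg_apply]

lemma apply_self (h : IsQuaternionic G J) (a : Fin 3) (v : Euc 4) : G (J a v) v = 0 :=
  self_eq_neg.1 (h.skew a v v)

/-- The expansion of `|x|² ⟨y, w⟩` in the orthogonal basis `x, Ix, Jx, Kx`. -/
lemma parseval (h : IsQuaternionic G J) (x y w : Euc 4) :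
    G x y * G x w + ∑ a, G (J a x) y * G (J a x) w = G x x * G y w := by
  rcases eq_or_ne x 0 with rfl | hx
  · simp
  have h01 : G (J 0 x) (J 1 x) = 0 := by
    rw [← h.orth 0, h.sq, h.quat, h.symm, map_neg, h.apply_self, neg_zero]
  have h02 : G (J 0 x) (J 2 x) = 0 := by
    rw [← h.quat, h.orth, h.symm, h.apply_self]
  have h12 : G (J 1 x) (J 2 x) = 0 := by
    rw [← h.quat, h.symm, h.apply_self]
  have hb : ∀ i j : Fin 4, G (![x, J 0 x, J 1 x, J 2 x] i) (![x, J 0 x, J 1 x, J 2 x] j)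
      = if i = j then G x x else 0 := by
    intro i j
    fin_cases i <;> fin_cases j <;>
      simp [h.orth, h.apply_self, h01, h02, h12, h.symm (J 1 x) (J 0 x), h.symm (J 2 x) (J 0 x),
        h.symm (J 2 x) (J 1 x), h.symm x]
  rw [← h.sum_mul_of_orthogonal (h.pos x hx).ne' hb, Fin.sum_univ_four, Fin.sum_univ_three]
  simp only [Matrix.cons_val]
  ring

lemma sum_mul_eq_zero (h : IsQuaternionic G J) {x y n : Euc 4} (hx : G x n = 0)
    (hy : G y n = 0) : ∑ a, G (J a x) y * G (J a x) n = 0 := by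
  simpa [hx, hy] using h.parseval x y n

lemma parseval_polar (h : IsQuaternionic G J) (x z y w : Euc 4) :
    ∑ a, (G (J a x) y * G (J a z) w + G (J a z) y * G (J a x) w)
      = 2 * G x z * G y w - G x y * G z w - G z y * G x w := by
  have hxz := h.parseval (x + z) y w
  have hx := h.parseval x y w
  have hz := h.parseval z y w
  simp only [map_add, add_apply, Fin.sum_univ_three] at hx hz hxz ⊢
  rw [h.symm z x] at hxz
  linarith

lemma sum_mul_of_orthogonal (h : IsQuaternionic G J) {x z n : Euc 4} (hx : G x n = 0)
    (hz : G z n = 0) (p q s : Euc 4) :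
    ∑ a, ((G (J a x) s - G (J a z) q) * G (J a x) n - (G (J a x) q - G (J a z) p) * G (J a z) n)
      = G x x * G s n - 2 * G x z * G q n + G z z * G p n := by
  have hxs := h.parseval x s n
  have hzp := h.parseval z p n
  have hxz := h.parseval_polar x z q n
  simp only [hx, hz, mul_zero, zero_add, sub_zero, Fin.sum_univ_three] at hxs hzp hxz ⊢
  linear_combination hxs + hzp - hxz

end IsQuaternionic

section Calculus

variable {E E' E'' : Type*} [NormedAddCommGroup E] [NormedSpace ℝ E] [NormedAddCommGroup E']
  [NormedSpace ℝ E'] [NormedAddCommGroup E''] [NormedSpace ℝ E'']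

lemma differentiableAt_of_contDiffOn {φ : E → E'} {U : Set E} (hφ : ContDiffOn ℝ ∞ φ U)
    (hU : IsOpen U) {y : E} (hy : y ∈ U) : DifferentiableAt ℝ φ y :=
  (hφ.contDiffAt (hU.mem_nhds hy)).differentiableAt (by simp)

lemma fderiv_fderiv_symm {φ : E → E'} {U : Set E} (hφ : ContDiffOn ℝ ∞ φ U) (hU : IsOpen U)
    {y : E} (hy : y ∈ U) (v w : E) :
    fderiv ℝ (fderiv ℝ φ) y v w = fderiv ℝ (fderiv ℝ φ) y w v :=
  ((hφ.contDiffAt (hU.mem_nhds hy)).isSymmSndFDerivAt (by simpa using ENat.LEInfty.out)).eq v w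

lemma fderiv_clm_const {φ : E → E' →L[ℝ] E''} {y : E} (hφ : DifferentiableAt ℝ φ y) (v : E)
    (w : E') : fderiv ℝ (fun z => φ z w) y v = fderiv ℝ φ y v w := by
  rw [fderiv_clm_apply hφ (differentiableAt_const w)]
  simp

lemma fderiv_comp_apply {φ : E' → E''} {f : E → E'} {y : E} (hφ : DifferentiableAt ℝ φ (f y))
    (hf : DifferentiableAt ℝ f y) (v : E) :
    fderiv ℝ (fun x => φ (f x)) y v = fderiv ℝ φ (f y) (fderiv ℝ f y v) := by
  rw [fderiv_fun_comp y hφ hf, ContinuousLinearMap.comp_apply]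

set_option synthInstance.maxHeartbeats 100000 in
-- The normed structure on `E' →L[ℝ] E' →L[ℝ] ℝ` is expensive to synthesize.
lemma fderiv_bilin_comp {c : E'' → E' →L[ℝ] E' →L[ℝ] ℝ} {f : E → E''} {a b : E → E'} {y : E}
    (hc : DifferentiableAt ℝ c (f y)) (hf : DifferentiableAt ℝ f y) (ha : DifferentiableAt ℝ a y)
    (hb : DifferentiableAt ℝ b y) (v : E) :
    fderiv ℝ (fun x => c (f x) (a x) (b x)) y v = fderiv ℝ c (f y) (fderiv ℝ f y v) (a y) (b y)
      + c (f y) (fderiv ℝ a y v) (b y) + c (f y) (a y) (fderiv ℝ b y v) := by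
  have hcf : DifferentiableAt ℝ (fun x => c (f x)) y :=
    DifferentiableAt.fun_comp' (G := E' →L[ℝ] E' →L[ℝ] ℝ) y hc hf
  rw [fderiv_clm_apply (hcf.clm_apply ha) hb, fderiv_clm_apply hcf ha]
  simp only [add_apply, ContinuousLinearMap.comp_apply, ContinuousLinearMap.flip_apply,
    fderiv_comp_apply (E'' := E' →L[ℝ] E' →L[ℝ] ℝ) hc hf]
  ring

lemma fderiv_bilin_const {c : E → E' →L[ℝ] E' →L[ℝ] ℝ} {y : E} (hc : DifferentiableAt ℝ c y)
    (v : E) (w z : E') : fderiv ℝ (fun x => c x w z) y v = fderiv ℝ c y v w z := by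
  rw [fderiv_clm_const (hc.clm_apply (differentiableAt_const w)), fderiv_clm_const hc]

lemma fderiv_bilin_symm {c : E → E' →L[ℝ] E' →L[ℝ] ℝ} {y : E} (hc : DifferentiableAt ℝ c y)
    (hsymm : ∀ᶠ x in nhds y, ∀ w z, c x w z = c x z w) (v : E) (w z : E') :
    fderiv ℝ c y v w z = fderiv ℝ c y v z w := by
  rw [← fderiv_bilin_const hc, ← fderiv_bilin_const hc,
    Filter.EventuallyEq.fderiv_eq (hsymm.mono fun x hx => hx w z)]

set_option synthInstance.maxHeartbeats 100000 in
-- The normed structure on `E' →L[ℝ] E' →L[ℝ] ℝ` is expensive to synthesize.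
lemma hasDerivWithinAt_bilin_comp {c : E → E' →L[ℝ] E' →L[ℝ] ℝ} {γ : ℝ → E} {γ' : E}
    {a b : ℝ → E'} {a' b' : E'} {T : Set ℝ} {t : ℝ} (hc : DifferentiableAt ℝ c (γ t))
    (hγ : HasDerivWithinAt γ γ' T t) (ha : HasDerivWithinAt a a' T t)
    (hb : HasDerivWithinAt b b' T t) :
    HasDerivWithinAt (fun s => c (γ s) (a s) (b s))
      (fderiv ℝ c (γ t) γ' (a t) (b t) + c (γ t) a' (b t) + c (γ t) (a t) b') T t := by
  have hcγ : HasDerivWithinAt (fun s => c (γ s)) (fderiv ℝ c (γ t) γ') T t :=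
    HasFDerivAt.comp_hasDerivWithinAt (E := E' →L[ℝ] E' →L[ℝ] ℝ) t hc.hasFDerivAt hγ
  have hca : HasDerivWithinAt (fun s => c (γ s) (a s))
      (fderiv ℝ c (γ t) γ' (a t) + c (γ t) a') T t := hcγ.clm_apply ha
  exact hca.clm_apply hb

lemma fderiv_fderiv_nonpos_of_isLocalMax {φ : E → ℝ} {y : E} (hφ : ContDiffAt ℝ 2 φ y)
    (hmax : IsLocalMax φ y) (v : E) : fderiv ℝ (fderiv ℝ φ) y v v ≤ 0 := by
  set γ : ℝ → E := fun s => y + s • v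
  have hγ0 : γ 0 = y := by simp [γ]
  have hγ : ∀ s, HasDerivAt γ v s := fun s =>
    (((hasDerivAt_id s).smul_const v).const_add y).congr_deriv (one_smul ℝ v)
  have hγy : Filter.Tendsto γ (nhds 0) (nhds y) := hγ0 ▸ (hγ 0).continuousAt.tendsto
  have hderiv : deriv (φ ∘ γ) =ᶠ[nhds 0] fun s => fderiv ℝ φ (γ s) v := by
    filter_upwards [hγy.eventually (hφ.eventually (by simp))] with s hs
    exact ((hs.differentiableAt (by simp)).hasFDerivAt.comp_hasDerivAt s (hγ s)).deriv
  have hderiv2 : deriv (deriv (φ ∘ γ)) 0 = fderiv ℝ (fderiv ℝ φ) y v v := by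
    have hd : DifferentiableAt ℝ (fderiv ℝ φ) (γ 0) :=
      hγ0 ▸ (hφ.fderiv_right (m := 1) (by norm_num)).differentiableAt (by simp)
    rw [hderiv.deriv_eq]
    refine ((hd.hasFDerivAt.comp_hasDerivAt 0 (hγ 0)).clm_apply (hasDerivAt_const 0 v)).deriv.trans
      ?_
    simp [hγ0]
  by_contra! hpos
  rw [← hderiv2] at hpos
  have hmax' : IsLocalMax (φ ∘ γ) 0 := by
    simpa only [IsLocalMax, IsMaxFilter, Function.comp_apply, hγ0] using hγy.eventually hmax
  have hcont : ContinuousAt (φ ∘ γ) 0 :=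
    ContinuousAt.comp (hγ0 ▸ hφ.continuousAt) (hγ 0).continuousAt
  have hmin : IsLocalMin (φ ∘ γ) 0 :=
    isLocalMin_of_deriv_deriv_pos hpos hmax'.deriv_eq_zero hcont
  have hconst : φ ∘ γ =ᶠ[nhds 0] fun _ => (φ ∘ γ) 0 := by
    filter_upwards [hmax', hmin] with s using le_antisymm
  rw [hconst.deriv.deriv_eq] at hpos
  simp at hpos

end Calculus

section Slices

variable {E E' : Type*} [NormedAddCommGroup E] [NormedSpace ℝ E] [NormedAddCommGroup E']
  [NormedSpace ℝ E'] {F : ℝ × E → E'} {T : Set ℝ} {U : Set E}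

lemma hasFDerivAt_slice (hU : IsOpen U) (hF : DifferentiableOn ℝ F (T ×ˢ U)) {t : ℝ} (ht : t ∈ T)
    {y : E} (hy : y ∈ U) :
    HasFDerivAt (fun x => F (t, x))
      ((fderivWithin ℝ F (T ×ˢ U) (t, y)).comp (ContinuousLinearMap.inr ℝ ℝ E)) y :=
  ((hF (t, y) ⟨ht, hy⟩).hasFDerivWithinAt.comp y
    (hasFDerivAt_prodMk_right t y).hasFDerivWithinAt
    fun _ hx => ⟨ht, hx⟩).hasFDerivAt (hU.mem_nhds hy)

lemma hasDerivWithinAt_slice (hF : DifferentiableOn ℝ F (T ×ˢ U)) {t : ℝ} (ht : t ∈ T)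
    {y : E} (hy : y ∈ U) :
    HasDerivWithinAt (fun s => F (s, y)) (fderivWithin ℝ F (T ×ˢ U) (t, y) (1, 0)) T t :=
  have hmaps : MapsTo (fun s : ℝ => (s, y)) T (T ×ˢ U) := fun _ hs => ⟨hs, hy⟩
  (hF (t, y) ⟨ht, hy⟩).hasFDerivWithinAt.comp_hasDerivWithinAt t
    ((hasDerivWithinAt_id t T).prodMk (hasDerivWithinAt_const t T y)) hmaps

lemma continuousOn_fderiv_slice (hT : UniqueDiffOn ℝ T) (hU : IsOpen U)
    (hF : ContDiffOn ℝ ∞ F (T ×ˢ U)) :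
    ContinuousOn (fun z : ℝ × E => fderiv ℝ (fun y => F (z.1, y)) z.2) (T ×ˢ U) :=
  ((hF.continuousOn_fderivWithin (hT.prod hU.uniqueDiffOn) (by simp)).clm_comp
    (continuousOn_const (c := ContinuousLinearMap.inr ℝ ℝ E))).congr fun _ hz =>
      (hasFDerivAt_slice hU (hF.differentiableOn (by simp)) hz.1 hz.2).fderiv

/-- Time and space derivatives of a smooth family commute, also at the ends of the time interval,
by the symmetry of second derivatives within `T ×ˢ U`. -/
lemma hasDerivWithinAt_fderiv_slice (hT : Convex ℝ T) (hT' : (interior T).Nonempty) (hU : IsOpen U)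
    (hF : ContDiffOn ℝ ∞ F (T ×ˢ U)) {V : E → E'} {t : ℝ} (ht : t ∈ T)
    (hV : ∀ y ∈ U, HasDerivWithinAt (fun s => F (s, y)) (V y) T t) {y : E} (hy : y ∈ U) (k : E) :
    DifferentiableAt ℝ V y ∧
    HasDerivWithinAt (fun s => fderiv ℝ (fun y => F (s, y)) y k) (fderiv ℝ V y k) T t := by
  have hTu : UniqueDiffOn ℝ T := uniqueDiffOn_convex hT hT'
  have hu : UniqueDiffOn ℝ (T ×ˢ U) := hTu.prod hU.uniqueDiffOn
  have hd : DifferentiableOn ℝ F (T ×ˢ U) := hF.differentiableOn (by simp)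
  set D := fderivWithin ℝ F (T ×ˢ U) with hD
  have hDd : DifferentiableOn ℝ D (T ×ˢ U) :=
    (hF.fderivWithin (m := ∞) hu (by simp)).differentiableOn (by simp)
  have hsymm : IsSymmSndFDerivWithinAt ℝ F (T ×ˢ U) (t, y) := by
    refine (hF (t, y) ⟨ht, hy⟩).isSymmSndFDerivWithinAt (by simpa using ENat.LEInfty.out) hu ?_
      ⟨ht, hy⟩
    rw [interior_prod_eq, closure_prod_eq, hU.interior_eq,
      hT.closure_interior_eq_closure_of_nonempty_interior hT']
    exact ⟨subset_closure ht, subset_closure hy⟩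
  have hVD : V =ᶠ[nhds y] fun x => D (t, x) (1, 0) := by
    filter_upwards [hU.mem_nhds hy] with x hx
    exact (hTu t ht).eq_deriv T (hV x hx) (hasDerivWithinAt_slice hd ht hx)
  have hV' : HasFDerivAt V ((ContinuousLinearMap.apply ℝ E' ((1 : ℝ), (0 : E))).comp
      ((fderivWithin ℝ D (T ×ˢ U) (t, y)).comp (ContinuousLinearMap.inr ℝ ℝ E))) y :=
    ((ContinuousLinearMap.apply ℝ E' ((1 : ℝ), (0 : E))).hasFDerivAt.comp y
      (hasFDerivAt_slice hU hDd ht hy)).congr_of_eventuallyEq hVD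
  have hslice : ∀ s ∈ T, fderiv ℝ (fun y => F (s, y)) y k = D (s, y) (0, k) := fun s hs => by
    rw [(hasFDerivAt_slice hU hd hs hy).fderiv]
    simp [hD]
  have hDt : HasDerivWithinAt (fun s => D (s, y) (0, k))
      (fderivWithin ℝ D (T ×ˢ U) (t, y) (1, 0) (0, k)) T t :=
    (ContinuousLinearMap.apply ℝ E' ((0 : ℝ), k)).hasFDerivAt.comp_hasDerivWithinAt t
      (hasDerivWithinAt_slice hDd ht hy)
  refine ⟨hV'.differentiableAt, (hDt.congr hslice (hslice t ht)).congr_deriv ?_⟩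
  rw [hV'.fderiv]
  exact hsymm.eq ((1 : ℝ), (0 : E)) ((0 : ℝ), k)

end Slices

/-- The parabolic maximum principle on a compact space: if `u` has nonpositive time derivative at
the spatial maxima, then the bound `C` persists. -/
lemma le_of_hasDerivWithinAt_nonpos_of_isMax {X : Type*} [TopologicalSpace X] [CompactSpace X]
    {u : ℝ → X → ℝ} {t C : ℝ} (ht : 0 ≤ t)
    (hu : ContinuousOn (fun z : ℝ × X => u z.1 z.2) (Icc 0 t ×ˢ univ))
    (hderiv : ∀ s ∈ Ioc 0 t, ∀ x, (∀ y, u s y ≤ u s x) →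
      ∃ r ≤ 0, HasDerivWithinAt (fun s' => u s' x) r (Icc 0 s) s)
    (h0 : ∀ x, u 0 x ≤ C) (x : X) : u t x ≤ C := by
  -- `u - ε s` cannot attain its maximum over `[0, t] × X` at a positive time.
  have hpert : ∀ ε > 0, u t x ≤ C + ε * t := by
    intro ε hε
    obtain ⟨⟨s, y⟩, ⟨hs, -⟩, hmax⟩ := (isCompact_Icc.prod isCompact_univ).exists_isMaxOn
      ⟨(t, x), ⟨⟨ht, le_rfl⟩, trivial⟩⟩
      (hu.sub ((continuousOn_const (c := ε)).mul continuousOn_fst))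
    have hle : ∀ s' ∈ Icc 0 t, ∀ y', u s' y' - ε * s' ≤ u s y - ε * s :=
      fun s' hs' y' => hmax (a := (s', y')) ⟨hs', trivial⟩
    suffices hs0 : s = 0 by
      subst hs0
      linarith [hle t ⟨ht, le_rfl⟩ x, h0 y]
    by_contra hne
    have hspos : 0 < s := lt_of_le_of_ne hs.1 (Ne.symm hne)
    obtain ⟨r, hr, hd⟩ := hderiv s ⟨hspos, hs.2⟩ y fun y' => by linarith [hle s hs y']
    have hd' := hd.sub ((hasDerivWithinAt_id s (Icc 0 s)).const_mul ε)
    have hlocmax : IsLocalMaxOn (fun s' => u s' y - ε * id s') (Icc 0 s) s := by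
      filter_upwards [self_mem_nhdsWithin] with s' hs'
      exact hle s' ⟨hs'.1, hs'.2.trans hs.2⟩ y
    have hcone : (0 : ℝ) - s ∈ posTangentConeAt (Icc 0 s) s :=
      sub_mem_posTangentConeAt_of_segment_subset
        (by rw [segment_symm, segment_eq_Icc hspos.le])
    have hnonpos := hlocmax.hasFDerivWithinAt_nonpos hd'.hasFDerivWithinAt hcone
    simp only [ContinuousLinearMap.toSpanSingleton_apply, smul_eq_mul, mul_one] at hnonpos
    nlinarith
  refine le_of_forall_pos_le_add fun δ hδ => (hpert (δ / (t + 1)) (by positivity)).trans ?_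
  have hδt : δ / (t + 1) * t ≤ δ := by
    rw [div_mul_eq_mul_div, div_le_iff₀ (by positivity)]
    nlinarith
  linarith

/-! ### Riemannian geometry in coordinates -/

/-- `G` is the coordinate expression of a smooth Riemannian metric on the open set `W`. -/
structure IsMetricOn {n : ℕ} (G : Euc n → BilinForm n) (W : Set (Euc n)) : Prop where
  isOpen : IsOpen W
  smooth : ContDiffOn ℝ ∞ G W
  isInner : ∀ z ∈ W, IsInner (G z)

/-- `Γ` is the Christoffel symbol at `z` of the Levi-Civita connection of `G`, given by Koszul's
formula for the coordinate fields. -/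
def IsLeviCivitaAt {n : ℕ} (G : Euc n → BilinForm n) (z : Euc n) (Γ : Euc n → Euc n → Euc n) :
    Prop :=
  ∀ v w u, G z (Γ v w) u
    = 1 / 2 * (fderiv ℝ G z v w u + fderiv ℝ G z w v u - fderiv ℝ G z u v w)

lemma IsInner.isLeviCivitaAt_metricTrace {n : ℕ} {G : Euc n → BilinForm n} {z : Euc n}
    (h : IsInner (G z)) :
    IsLeviCivitaAt G z fun v w => metricTrace (G z) fun a b =>
      (1 / 2 * (fderiv ℝ G z v w a + fderiv ℝ G z w v a - fderiv ℝ G z a v w)) • b :=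
  fun v w u => h.inner_metricTrace_smul (((1 / 2 : ℝ) • (fderiv ℝ G z v w + fderiv ℝ G z w v
    - ((fderiv ℝ G z).flip v).flip w) : Euc n →L[ℝ] ℝ) : Euc n →ₗ[ℝ] ℝ) u

namespace IsMetricOn

variable {n : ℕ} {G : Euc n → BilinForm n} {W : Set (Euc n)} {z : Euc n}
  {Γ : Euc n → Euc n → Euc n}

lemma differentiableAt (h : IsMetricOn G W) (hz : z ∈ W) : DifferentiableAt ℝ G z :=
  differentiableAt_of_contDiffOn h.smooth h.isOpen hz

lemma fderiv_symm (h : IsMetricOn G W) (hz : z ∈ W) (v w u : Euc n) :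
    fderiv ℝ G z v w u = fderiv ℝ G z v u w :=
  fderiv_bilin_symm (h.differentiableAt hz)
    (Filter.mem_of_superset (h.isOpen.mem_nhds hz) fun x hx => (h.isInner x hx).symm) v w u

lemma leviCivita_symm (h : IsMetricOn G W) (hz : z ∈ W) (hΓ : IsLeviCivitaAt G z Γ)
    (v w : Euc n) : Γ v w = Γ w v :=
  (h.isInner z hz).ext_inner fun u => by
    rw [(h.isInner z hz).symm, (h.isInner z hz).symm u, hΓ, hΓ, h.fderiv_symm hz u v w]
    ring

lemma fderiv_eq_leviCivita (h : IsMetricOn G W) (hz : z ∈ W) (hΓ : IsLeviCivitaAt G z Γ)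
    (v w u : Euc n) : fderiv ℝ G z v w u = G z (Γ v w) u + G z w (Γ v u) := by
  rw [(h.isInner z hz).symm w, hΓ, hΓ, h.fderiv_symm hz v u w, h.fderiv_symm hz w v u,
    h.fderiv_symm hz u v w]
  ring

end IsMetricOn

section Patch

variable {m n : ℕ}

/-- The metric induced by the map `F` from the metric `G`. -/
def coordMetric (G : Euc n → BilinForm n) (F : Euc m → Euc n) (y : Euc m) : BilinForm m :=
  pullForm (G (F y)) (fderiv ℝ F y)

/-- The covariant derivative along `F` of the coordinate field `F_* w` in the direction `v`, for
the connection with Christoffel symbol `Γ` at `F y`. -/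
def coordCovDeriv (Γ : Euc n → Euc n → Euc n) (F : Euc m → Euc n) (y v w : Euc m) : Euc n :=
  fderiv ℝ (fderiv ℝ F) y v w + Γ (fderiv ℝ F y v) (fderiv ℝ F y w)

/-- The second fundamental form of the immersion `F`. -/
def coordSecondFF (G : Euc n → BilinForm n) (Γ : Euc n → Euc n → Euc n) (F : Euc m → Euc n)
    (y v w : Euc m) : Euc n :=
  normalProj (G (F y)) (fderiv ℝ F y) (coordCovDeriv Γ F y v w)

/-- The mean curvature vector of the immersion `F`. -/
def coordMeanCurv (G : Euc n → BilinForm n) (Γ : Euc n → Euc n → Euc n) (F : Euc m → Euc n)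
    (y : Euc m) : Euc n :=
  metricTrace (coordMetric G F y) (coordSecondFF G Γ F y)

/-- `F : U → W` is a smooth immersion into a domain `W` with the metric `G`. -/
structure IsImmersedPatch (G : Euc n → BilinForm n) (W : Set (Euc n)) (U : Set (Euc m))
    (F : Euc m → Euc n) : Prop where
  isMetricOn : IsMetricOn G W
  isOpen : IsOpen U
  smooth : ContDiffOn ℝ ∞ F U
  mapsTo : MapsTo F U W
  injective : ∀ y ∈ U, Function.Injective (fderiv ℝ F y)

namespace IsImmersedPatch

variable {G : Euc n → BilinForm n} {W : Set (Euc n)} {U : Set (Euc m)} {F : Euc m → Euc n}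
  {y : Euc m} {Γ : Euc n → Euc n → Euc n} {γ : Euc m → Euc m → Euc m}

lemma isInner (h : IsImmersedPatch G W U F) (hy : y ∈ U) : IsInner (G (F y)) :=
  h.isMetricOn.isInner _ (h.mapsTo hy)

lemma fderiv_smooth (h : IsImmersedPatch G W U F) : ContDiffOn ℝ ∞ (fderiv ℝ F) U :=
  h.smooth.fderiv_of_isOpen h.isOpen (by simp)

lemma metric_comp_smooth (h : IsImmersedPatch G W U F) : ContDiffOn ℝ ∞ (fun x => G (F x)) U :=
  h.isMetricOn.smooth.comp h.smooth h.mapsTo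

lemma isMetricOn_coordMetric (h : IsImmersedPatch G W U F) : IsMetricOn (coordMetric G F) U where
  isOpen := h.isOpen
  smooth := by
    simp only [contDiffOn_clm_apply]
    exact fun v w => (h.metric_comp_smooth.clm_apply
      (h.fderiv_smooth.clm_apply contDiffOn_const)).clm_apply
      (h.fderiv_smooth.clm_apply contDiffOn_const)
  isInner y hy := (h.isInner hy).pull (h.injective y hy)

lemma differentiableAt_fderiv (h : IsImmersedPatch G W U F) (hy : y ∈ U) :
    DifferentiableAt ℝ (fderiv ℝ F) y :=
  differentiableAt_of_contDiffOn h.fderiv_smooth h.isOpen hy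

lemma differentiableAt_fderiv_apply (h : IsImmersedPatch G W U F) (hy : y ∈ U) (w : Euc m) :
    DifferentiableAt ℝ (fun x => fderiv ℝ F x w) y :=
  (h.differentiableAt_fderiv hy).clm_apply (differentiableAt_const w)

lemma differentiableAt (h : IsImmersedPatch G W U F) (hy : y ∈ U) : DifferentiableAt ℝ F y :=
  differentiableAt_of_contDiffOn h.smooth h.isOpen hy

lemma coordCovDeriv_symm (h : IsImmersedPatch G W U F) (hy : y ∈ U)
    (hΓ : IsLeviCivitaAt G (F y) Γ) (v w : Euc m) :
    coordCovDeriv Γ F y v w = coordCovDeriv Γ F y w v := by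
  rw [coordCovDeriv, coordCovDeriv, fderiv_fderiv_symm h.smooth h.isOpen hy,
    h.isMetricOn.leviCivita_symm (h.mapsTo hy) hΓ]

lemma fderiv_inner (h : IsImmersedPatch G W U F) (hy : y ∈ U) {a b : Euc m → Euc n}
    (ha : DifferentiableAt ℝ a y) (hb : DifferentiableAt ℝ b y) (v : Euc m) :
    fderiv ℝ (fun x => G (F x) (a x) (b x)) y v
      = fderiv ℝ G (F y) (fderiv ℝ F y v) (a y) (b y) + G (F y) (fderiv ℝ a y v) (b y)
        + G (F y) (a y) (fderiv ℝ b y v) :=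
  fderiv_bilin_comp (h.isMetricOn.differentiableAt (h.mapsTo hy)) (h.differentiableAt hy) ha hb v

lemma fderiv_inner_eq_leviCivita (h : IsImmersedPatch G W U F) (hy : y ∈ U)
    (hΓ : IsLeviCivitaAt G (F y) Γ) {a b : Euc m → Euc n} (ha : DifferentiableAt ℝ a y)
    (hb : DifferentiableAt ℝ b y) (v : Euc m) :
    fderiv ℝ (fun x => G (F x) (a x) (b x)) y v
      = G (F y) (fderiv ℝ a y v + Γ (fderiv ℝ F y v) (a y)) (b y)
        + G (F y) (a y) (fderiv ℝ b y v + Γ (fderiv ℝ F y v) (b y)) := by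
  rw [h.fderiv_inner hy ha hb, h.isMetricOn.fderiv_eq_leviCivita (h.mapsTo hy) hΓ]
  simp only [map_add, add_apply]
  ring

lemma fderiv_coordMetric (h : IsImmersedPatch G W U F) (hy : y ∈ U)
    (hΓ : IsLeviCivitaAt G (F y) Γ) (v w z : Euc m) :
    fderiv ℝ (coordMetric G F) y v w z = G (F y) (coordCovDeriv Γ F y v w) (fderiv ℝ F y z)
      + G (F y) (fderiv ℝ F y w) (coordCovDeriv Γ F y v z) := by
  rw [← fderiv_bilin_const (h.isMetricOn_coordMetric.differentiableAt hy)]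
  refine (h.fderiv_inner_eq_leviCivita hy hΓ (h.differentiableAt_fderiv_apply hy w)
    (h.differentiableAt_fderiv_apply hy z) v).trans ?_
  rw [fderiv_clm_const (h.differentiableAt_fderiv hy),
    fderiv_clm_const (h.differentiableAt_fderiv hy)]
  rfl

/-- The tangential part of the Levi-Civita connection is the Levi-Civita connection of the induced
metric. -/
lemma inner_leviCivita (h : IsImmersedPatch G W U F) (hy : y ∈ U) (hΓ : IsLeviCivitaAt G (F y) Γ)
    (hγ : IsLeviCivitaAt (coordMetric G F) y γ) (v w z : Euc m) :
    coordMetric G F y (γ v w) z = G (F y) (coordCovDeriv Γ F y v w) (fderiv ℝ F y z) := by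
  simp only [hγ v w z, h.fderiv_coordMetric hy hΓ]
  rw [h.coordCovDeriv_symm hy hΓ w v, h.coordCovDeriv_symm hy hΓ z v,
    h.coordCovDeriv_symm hy hΓ z w, (h.isInner hy).symm _ (coordCovDeriv Γ F y w z),
    (h.isInner hy).symm (fderiv ℝ F y w)]
  ring

lemma coordSecondFF_eq (h : IsImmersedPatch G W U F) (hy : y ∈ U) (hΓ : IsLeviCivitaAt G (F y) Γ)
    (hγ : IsLeviCivitaAt (coordMetric G F) y γ) (v w : Euc m) :
    coordSecondFF G Γ F y v w = coordCovDeriv Γ F y v w - fderiv ℝ F y (γ v w) :=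
  (h.isInner hy).normalProj_eq (h.injective y hy) (h.inner_leviCivita hy hΓ hγ v w)

lemma inner_coordSecondFF (h : IsImmersedPatch G W U F) (hy : y ∈ U) (v w z : Euc m) :
    G (F y) (fderiv ℝ F y z) (coordSecondFF G Γ F y v w) = 0 := by
  rw [(h.isInner hy).symm]
  exact (h.isInner hy).inner_normalProj (h.injective y hy) _ z

lemma inner_coordMeanCurv (h : IsImmersedPatch G W U F) (hy : y ∈ U)
    (hΓ : IsLeviCivitaAt G (F y) Γ) {ν : Euc n} (hν : ∀ v, G (F y) (fderiv ℝ F y v) ν = 0) :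
    G (F y) (coordMeanCurv G Γ F y) ν
      = metricTrace (coordMetric G F y) fun v w => G (F y) (coordCovDeriv Γ F y v w) ν := by
  have hγ := (h.isMetricOn_coordMetric.isInner y hy).isLeviCivitaAt_metricTrace
  have hmap := map_metricTrace ((G (F y)).flip ν : Euc n →ₗ[ℝ] ℝ) (coordMetric G F y)
    (coordSecondFF G Γ F y)
  simpa only [ContinuousLinearMap.coe_coe, ContinuousLinearMap.flip_apply,
    h.coordSecondFF_eq hy hΓ hγ, map_sub, sub_apply, hν, sub_zero, coordMeanCurv,
    funext fun v => funext fun w => h.coordSecondFF_eq hy hΓ hγ v w] using hmap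

/-- The first variation of the induced metric under a variation `V` with tangential part dual to
the one-form `θ`. The left hand side is the time derivative of `coordMetric G F y v w` when
`∂F/∂t = V`. -/
lemma first_variation (h : IsImmersedPatch G W U F) (hy : y ∈ U) (hΓ : IsLeviCivitaAt G (F y) Γ)
    (hγ : IsLeviCivitaAt (coordMetric G F) y γ) {V : Euc m → Euc n} (hV : DifferentiableAt ℝ V y)
    {θ : Euc m → Euc m →L[ℝ] ℝ} (hθ : DifferentiableAt ℝ θ y)
    (hVθ : ∀ x ∈ U, ∀ w, G (F x) (V x) (fderiv ℝ F x w) = θ x w) (v w : Euc m) :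
    fderiv ℝ G (F y) (V y) (fderiv ℝ F y v) (fderiv ℝ F y w)
        + G (F y) (fderiv ℝ V y v) (fderiv ℝ F y w) + G (F y) (fderiv ℝ F y v) (fderiv ℝ V y w)
      = fderiv ℝ θ y v w + fderiv ℝ θ y w v - 2 * θ y (γ v w)
        - 2 * G (F y) (V y) (coordSecondFF G Γ F y v w) := by
  have hWy := h.mapsTo hy
  have hdθ : ∀ v w, fderiv ℝ θ y v w
      = fderiv ℝ G (F y) (fderiv ℝ F y v) (V y) (fderiv ℝ F y w)
        + G (F y) (fderiv ℝ V y v) (fderiv ℝ F y w)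
        + G (F y) (V y) (fderiv ℝ (fderiv ℝ F) y v w) := fun v w => by
    have hev : (fun x => θ x w) =ᶠ[nhds y] fun x => G (F x) (V x) (fderiv ℝ F x w) := by
      filter_upwards [h.isOpen.mem_nhds hy] with x hx using (hVθ x hx w).symm
    rw [← fderiv_clm_const hθ, hev.fderiv_eq,
      h.fderiv_inner hy hV (h.differentiableAt_fderiv_apply hy w),
      fderiv_clm_const (h.differentiableAt_fderiv hy)]
  have hII : G (F y) (V y) (coordSecondFF G Γ F y v w)
      = G (F y) (V y) (fderiv ℝ (fderiv ℝ F) y v w)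
        + G (F y) (Γ (fderiv ℝ F y v) (fderiv ℝ F y w)) (V y) - θ y (γ v w) := by
    rw [h.coordSecondFF_eq hy hΓ hγ, map_sub, hVθ y hy, coordCovDeriv, map_add,
      (h.isInner hy).symm (V y) (Γ _ _)]
  rw [hΓ] at hII
  rw [hII, hdθ, hdθ, fderiv_fderiv_symm h.smooth h.isOpen hy w v,
    h.isMetricOn.fderiv_symm hWy _ (V y) (fderiv ℝ F y w),
    h.isMetricOn.fderiv_symm hWy _ (V y) (fderiv ℝ F y v), (h.isInner hy).symm (fderiv ℝ F y v)]
  ring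

end IsImmersedPatch

end Patch

/-! ### Surfaces in a coordinate domain of a hyperkähler manifold -/

/-- The field of endomorphisms `A` is parallel at `z` for the connection with Christoffel
symbol `Γ`. -/
def IsParallelAt {n : ℕ} (A : Euc n → Euc n →L[ℝ] Euc n) (z : Euc n)
    (Γ : Euc n → Euc n → Euc n) : Prop :=
  ∀ v w, fderiv ℝ A z v w + Γ v (A z w) - A z (Γ v w) = 0

/-- The component on `∂₀ ∧ ∂₁` of the pullback under `F` of the form `(v, w) ↦ G(Av, w)`. -/
def coordKahler {n : ℕ} (G : Euc n → BilinForm n) (A : Euc n → Euc n →L[ℝ] Euc n)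
    (F : Euc 2 → Euc n) (y : Euc 2) : ℝ :=
  G (F y) (A (F y) (fderiv ℝ F y (basisVec 2 0))) (fderiv ℝ F y (basisVec 2 1))

namespace IsImmersedPatch

variable {n : ℕ} {G : Euc n → BilinForm n} {W : Set (Euc n)} {U : Set (Euc 2)} {F : Euc 2 → Euc n}
  {A : Euc n → Euc n →L[ℝ] Euc n} {y : Euc 2} {Γ : Euc n → Euc n → Euc n}

lemma coordKahler_smooth (h : IsImmersedPatch G W U F) (hA : ContDiffOn ℝ ∞ A W) :
    ContDiffOn ℝ ∞ (coordKahler G A F) U :=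
  (h.metric_comp_smooth.clm_apply ((hA.comp h.smooth h.mapsTo).clm_apply
    (h.fderiv_smooth.clm_apply contDiffOn_const))).clm_apply
    (h.fderiv_smooth.clm_apply contDiffOn_const)

lemma fderiv_coordKahler (h : IsImmersedPatch G W U F) (hy : y ∈ U) (hΓ : IsLeviCivitaAt G (F y) Γ)
    (hA : DifferentiableAt ℝ A (F y)) (hpar : IsParallelAt A (F y) Γ) (v : Euc 2) :
    fderiv ℝ (coordKahler G A F) y v
      = G (F y) (A (F y) (coordCovDeriv Γ F y v (basisVec 2 0))) (fderiv ℝ F y (basisVec 2 1))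
      + G (F y) (A (F y) (fderiv ℝ F y (basisVec 2 0)))
        (coordCovDeriv Γ F y v (basisVec 2 1)) := by
  have hAF : DifferentiableAt ℝ (fun x => A (F x)) y := hA.fun_comp' y (h.differentiableAt hy)
  have hcov : fderiv ℝ (fun x => A (F x) (fderiv ℝ F x (basisVec 2 0))) y v
      + Γ (fderiv ℝ F y v) (A (F y) (fderiv ℝ F y (basisVec 2 0)))
      = A (F y) (coordCovDeriv Γ F y v (basisVec 2 0)) := by
    rw [fderiv_clm_apply hAF (h.differentiableAt_fderiv_apply hy _)]
    simp only [add_apply, ContinuousLinearMap.comp_apply, ContinuousLinearMap.flip_apply]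
    rw [fderiv_clm_const (h.differentiableAt_fderiv hy),
      fderiv_comp_apply hA (h.differentiableAt hy), coordCovDeriv, map_add, add_assoc,
      sub_eq_zero.1 (hpar _ _)]
  refine (h.fderiv_inner_eq_leviCivita hy hΓ
    (hAF.clm_apply (h.differentiableAt_fderiv_apply hy (basisVec 2 0)))
    (h.differentiableAt_fderiv_apply hy (basisVec 2 1)) v).trans ?_
  rw [hcov, fderiv_clm_const (h.differentiableAt_fderiv hy)]
  rfl

end IsImmersedPatch

/-- The function `λ²` of the patch `F` for the area form `r dx⁰ ∧ dx¹`. -/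
def coordLamSq {n : ℕ} (G : Euc n → BilinForm n) (r : Euc 2 → ℝ) (F : Euc 2 → Euc n)
    (y : Euc 2) : ℝ :=
  (gram (coordMetric G F y)).det / r y ^ 2

/-- The function `N` of the patch `F` for the two-form `(v, w) ↦ G(Av, w)` and the area form
`r dx⁰ ∧ dx¹`. -/
def coordMoment {n : ℕ} (G : Euc n → BilinForm n) (A : Euc n → Euc n →L[ℝ] Euc n) (r : Euc 2 → ℝ)
    (F : Euc 2 → Euc n) (y : Euc 2) : ℝ :=
  coordKahler G A F y / r y

/-- `V` is the velocity `∑ J_a F_* η_a` of the H-flow at `y`, where `η_a` is the Hamiltonian vector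
field of `N_a` for the area form `r dx⁰ ∧ dx¹`. -/
def IsFlowVelocity (G : Euc 4 → BilinForm 4) (J : Fin 3 → Euc 4 → Euc 4 →L[ℝ] Euc 4)
    (r : Euc 2 → ℝ) (F : Euc 2 → Euc 4) (y : Euc 2) (V : Euc 4) : Prop :=
  ∃ η : Fin 3 → Euc 2, (∀ a v, r y * wedge (η a) v = fderiv ℝ (coordMoment G (J a) r F) y v) ∧
    V = ∑ a, J a (F y) (fderiv ℝ F y (η a))

/-- `F` is an immersed surface with an area form `r dx⁰ ∧ dx¹` in a domain `W` with a smooth metric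
and smooth orthogonal almost complex structures `I`, `J`, `K`. -/
structure IsHyperkahlerPatch (G : Euc 4 → BilinForm 4) (J : Fin 3 → Euc 4 → Euc 4 →L[ℝ] Euc 4)
    (W : Set (Euc 4)) (r : Euc 2 → ℝ) (U : Set (Euc 2)) (F : Euc 2 → Euc 4) : Prop
    extends IsImmersedPatch G W U F where
  quaternionic : ∀ z ∈ W, IsQuaternionic (G z) fun a => J a z
  cplx_smooth : ∀ a, ContDiffOn ℝ ∞ (J a) W
  area_smooth : ContDiffOn ℝ ∞ r U
  area_ne_zero : ∀ y ∈ U, r y ≠ 0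

namespace IsHyperkahlerPatch

variable {G : Euc 4 → BilinForm 4} {J : Fin 3 → Euc 4 → Euc 4 →L[ℝ] Euc 4} {W : Set (Euc 4)}
  {r : Euc 2 → ℝ} {U : Set (Euc 2)} {F : Euc 2 → Euc 4} {y : Euc 2} {V ν : Euc 4}
  {Γ : Euc 4 → Euc 4 → Euc 4} {γ : Euc 2 → Euc 2 → Euc 2}

lemma isQuaternionic (h : IsHyperkahlerPatch G J W r U F) (hy : y ∈ U) :
    IsQuaternionic (G (F y)) fun a => J a (F y) :=
  h.quaternionic _ (h.mapsTo hy)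

lemma coordMoment_smooth (h : IsHyperkahlerPatch G J W r U F) (a : Fin 3) :
    ContDiffOn ℝ ∞ (coordMoment G (J a) r F) U :=
  (h.coordKahler_smooth (h.cplx_smooth a)).div h.area_smooth h.area_ne_zero

lemma differentiableAt_coordMoment (h : IsHyperkahlerPatch G J W r U F) (hy : y ∈ U) (a : Fin 3) :
    DifferentiableAt ℝ (coordMoment G (J a) r F) y :=
  differentiableAt_of_contDiffOn (h.coordMoment_smooth a) h.isOpen hy

lemma coordLamSq_eq (h : IsHyperkahlerPatch G J W r U F) (hy : y ∈ U) :
    coordLamSq G r F y = ∑ a, coordMoment G (J a) r F y ^ 2 := by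
  have hparseval := (h.isQuaternionic hy).parseval (fderiv ℝ F y (basisVec 2 0))
    (fderiv ℝ F y (basisVec 2 1)) (fderiv ℝ F y (basisVec 2 1))
  have hdet := (h.isMetricOn_coordMetric.isInner y hy).det_gram_eq
  simp only [← sq, coordMetric, pullForm, ContinuousLinearMap.bilinearComp_apply]
    at hparseval hdet
  simp only [coordLamSq, coordMetric, hdet, ← hparseval, add_sub_cancel_left, pullForm, coordMoment,
    coordKahler, div_pow, Finset.sum_div]

lemma coordLamSq_smooth (h : IsHyperkahlerPatch G J W r U F) :
    ContDiffOn ℝ ∞ (coordLamSq G r F) U :=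
  (ContDiffOn.sum fun a _ => (h.coordMoment_smooth a).pow 2).congr fun _ hy => h.coordLamSq_eq hy

lemma inner_cplx_apply (h : IsHyperkahlerPatch G J W r U F) (hy : y ∈ U) (a : Fin 3) (v w : Euc 2) :
    G (F y) (J a (F y) (fderiv ℝ F y v)) (fderiv ℝ F y w)
      = wedge v w * coordKahler G (J a) F y :=
  alternating_apply (β := pullForm ((G (F y)).comp (J a (F y))) (fderiv ℝ F y))
    (fun v => (h.isQuaternionic hy).apply_self a (fderiv ℝ F y v)) v w

/-- The tangential part of the velocity of the H-flow is `½ ∇ λ²`. -/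
lemma inner_velocity_tangent (h : IsHyperkahlerPatch G J W r U F) (hy : y ∈ U)
    (hV : IsFlowVelocity G J r F y V) (v : Euc 2) :
    G (F y) V (fderiv ℝ F y v) = ((1 / 2 : ℝ) • fderiv ℝ (coordLamSq G r F) y) v := by
  obtain ⟨η, hη, rfl⟩ := hV
  have hev : coordLamSq G r F =ᶠ[nhds y] fun x => ∑ a, coordMoment G (J a) r F x ^ 2 := by
    filter_upwards [h.isOpen.mem_nhds hy] with x hx using h.coordLamSq_eq hx
  have hfderiv : HasFDerivAt (fun x => ∑ a, coordMoment G (J a) r F x ^ 2)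
      (∑ a, (2 * coordMoment G (J a) r F y) • fderiv ℝ (coordMoment G (J a) r F) y) y :=
    HasFDerivAt.fun_sum fun a _ => by
      simpa using (h.differentiableAt_coordMoment hy a).hasFDerivAt.pow 2
  rw [hev.fderiv_eq, hfderiv.fderiv, map_sum, sum_apply, smul_apply, sum_apply, Finset.smul_sum]
  refine Finset.sum_congr rfl fun a _ => ?_
  have hr := h.area_ne_zero y hy
  rw [h.inner_cplx_apply hy, smul_apply, ← hη, smul_eq_mul, smul_eq_mul, coordMoment]
  field_simp

lemma area_mul_fderiv_coordMoment (h : IsHyperkahlerPatch G J W r U F) (hy : y ∈ U) (a : Fin 3)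
    (v : Euc 2) : r y * fderiv ℝ (coordMoment G (J a) r F) y v
      = fderiv ℝ (coordKahler G (J a) F) y v - coordMoment G (J a) r F y * fderiv ℝ r y v := by
  have hev : coordKahler G (J a) F =ᶠ[nhds y] fun x => coordMoment G (J a) r F x * r x := by
    filter_upwards [h.isOpen.mem_nhds hy] with x hx
    rw [coordMoment, div_mul_cancel₀ _ (h.area_ne_zero x hx)]
  rw [hev.fderiv_eq, fderiv_fun_mul (h.differentiableAt_coordMoment hy a)
    (differentiableAt_of_contDiffOn h.area_smooth h.isOpen hy)]
  simp

lemma sum_coordMoment_mul_inner (h : IsHyperkahlerPatch G J W r U F) (hy : y ∈ U)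
    (hν : ∀ v, G (F y) (fderiv ℝ F y v) ν = 0) (v : Euc 2) :
    ∑ a, coordMoment G (J a) r F y * G (F y) (J a (F y) (fderiv ℝ F y v)) ν = 0 := by
  have hbasis : ∀ i j, wedge (basisVec 2 i) (basisVec 2 j) ≠ 0 → ∑ a, coordMoment G (J a) r F y
      * G (F y) (J a (F y) (fderiv ℝ F y (basisVec 2 i))) ν = 0 := fun i j hij => by
    have hzero := (h.isQuaternionic hy).sum_mul_eq_zero (hν (basisVec 2 i)) (hν (basisVec 2 j))
    simp only [h.inner_cplx_apply hy, mul_assoc, ← Finset.mul_sum] at hzero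
    simp only [coordMoment, div_mul_eq_mul_div, ← Finset.sum_div,
      (mul_eq_zero.1 hzero).resolve_left hij, zero_div]
  rw [eq_smul_basisVec v]
  simp only [map_add, map_smul, add_apply, smul_apply, smul_eq_mul, mul_add, Finset.sum_add_distrib]
  simp only [mul_left_comm _ (v _), ← Finset.mul_sum]
  rw [hbasis 0 1 (by simp [wedge, basisVec]), hbasis 1 0 (by simp [wedge, basisVec]), mul_zero,
    mul_zero, add_zero]

lemma sum_fderiv_coordKahler_mul (h : IsHyperkahlerPatch G J W r U F) (hy : y ∈ U)
    (hΓ : IsLeviCivitaAt G (F y) Γ) (hJ : ∀ a, IsParallelAt (J a) (F y) Γ)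
    (hν : ∀ v, G (F y) (fderiv ℝ F y v) ν = 0) :
    ∑ a, (fderiv ℝ (coordKahler G (J a) F) y (basisVec 2 1)
          * G (F y) (J a (F y) (fderiv ℝ F y (basisVec 2 0))) ν
        - fderiv ℝ (coordKahler G (J a) F) y (basisVec 2 0)
          * G (F y) (J a (F y) (fderiv ℝ F y (basisVec 2 1))) ν)
      = (gram (coordMetric G F y)).det * G (F y) (coordMeanCurv G Γ F y) ν := by
  have hq := h.isQuaternionic hy
  have hdJ := fun a => differentiableAt_of_contDiffOn (h.cplx_smooth a) h.isMetricOn.isOpen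
    (h.mapsTo hy)
  rw [h.inner_coordMeanCurv hy hΓ hν, ← smul_eq_mul (gram _).det,
    (h.isMetricOn_coordMetric.isInner y hy).det_gram_smul_metricTrace]
  simp only [h.fderiv_coordKahler hy hΓ (hdJ _) (hJ _), hq.skew _ (coordCovDeriv _ _ _ _ _),
    neg_add_eq_sub]
  rw [h.coordCovDeriv_symm hy hΓ (basisVec 2 1) (basisVec 2 0)]
  refine (hq.sum_mul_of_orthogonal (hν (basisVec 2 0)) (hν (basisVec 2 1)) _ _ _).trans ?_
  simp only [coordMetric, pullForm, ContinuousLinearMap.bilinearComp_apply, smul_eq_mul]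
  ring

/-- The normal part of the velocity of the H-flow is `λ² H`. -/
lemma inner_velocity_normal (h : IsHyperkahlerPatch G J W r U F) (hy : y ∈ U)
    (hΓ : IsLeviCivitaAt G (F y) Γ) (hJ : ∀ a, IsParallelAt (J a) (F y) Γ)
    (hV : IsFlowVelocity G J r F y V) (hν : ∀ v, G (F y) (fderiv ℝ F y v) ν = 0) :
    G (F y) V ν = coordLamSq G r F y * G (F y) (coordMeanCurv G Γ F y) ν := by
  obtain ⟨η, hη, rfl⟩ := hV
  have hterm : ∀ a, r y ^ 2 * G (F y) (J a (F y) (fderiv ℝ F y (η a))) ν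
      = (fderiv ℝ (coordKahler G (J a) F) y (basisVec 2 1)
            * G (F y) (J a (F y) (fderiv ℝ F y (basisVec 2 0))) ν
          - fderiv ℝ (coordKahler G (J a) F) y (basisVec 2 0)
            * G (F y) (J a (F y) (fderiv ℝ F y (basisVec 2 1))) ν)
        - fderiv ℝ r y (basisVec 2 1)
          * (coordMoment G (J a) r F y * G (F y) (J a (F y) (fderiv ℝ F y (basisVec 2 0))) ν)
        + fderiv ℝ r y (basisVec 2 0)
          * (coordMoment G (J a) r F y * G (F y) (J a (F y) (fderiv ℝ F y (basisVec 2 1))) ν) :=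
    fun a => by
    rw [sq, mul_assoc, ← smul_eq_mul (r y) (G _ _ _), ← smul_apply, ← map_smul, ← map_smul,
      ← map_smul, smul_eq_of_wedge (hη a)]
    simp only [map_sub, map_smul, sub_apply, smul_apply, smul_eq_mul]
    linear_combination
      G (F y) (J a (F y) (fderiv ℝ F y (basisVec 2 0))) ν
          * h.area_mul_fderiv_coordMoment hy a (basisVec 2 1)
        - G (F y) (J a (F y) (fderiv ℝ F y (basisVec 2 1))) ν
          * h.area_mul_fderiv_coordMoment hy a (basisVec 2 0)
  have hsum : r y ^ 2 * ∑ a, G (F y) (J a (F y) (fderiv ℝ F y (η a))) ν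
      = (gram (coordMetric G F y)).det * G (F y) (coordMeanCurv G Γ F y) ν := by
    rw [Finset.mul_sum, Finset.sum_congr rfl fun a _ => hterm a, Finset.sum_add_distrib,
      Finset.sum_sub_distrib, h.sum_fderiv_coordKahler_mul hy hΓ hJ hν, ← Finset.mul_sum,
      ← Finset.mul_sum, h.sum_coordMoment_mul_inner hy hν, h.sum_coordMoment_mul_inner hy hν]
    ring
  rw [map_sum, sum_apply, coordLamSq, div_mul_eq_mul_div, ← hsum,
    mul_div_cancel_left₀ _ (pow_ne_zero 2 (h.area_ne_zero y hy))]

lemma metric_variation (h : IsHyperkahlerPatch G J W r U F) (hy : y ∈ U)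
    (hΓ : IsLeviCivitaAt G (F y) Γ) (hJ : ∀ a, IsParallelAt (J a) (F y) Γ)
    (hγ : IsLeviCivitaAt (coordMetric G F) y γ) {V : Euc 2 → Euc 4} (hVd : DifferentiableAt ℝ V y)
    (hV : ∀ x ∈ U, IsFlowVelocity G J r F x (V x)) (v w : Euc 2) :
    fderiv ℝ G (F y) (V y) (fderiv ℝ F y v) (fderiv ℝ F y w)
        + G (F y) (fderiv ℝ V y v) (fderiv ℝ F y w) + G (F y) (fderiv ℝ F y v) (fderiv ℝ V y w)
      = fderiv ℝ (fderiv ℝ (coordLamSq G r F)) y v w - fderiv ℝ (coordLamSq G r F) y (γ v w)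
        - 2 * coordLamSq G r F y *
          G (F y) (coordMeanCurv G Γ F y) (coordSecondFF G Γ F y v w) := by
  have hdu : DifferentiableAt ℝ (fderiv ℝ (coordLamSq G r F)) y :=
    differentiableAt_of_contDiffOn (h.coordLamSq_smooth.fderiv_of_isOpen h.isOpen (by simp))
      h.isOpen hy
  rw [h.first_variation hy hΓ hγ hVd (hdu.const_smul (1 / 2 : ℝ))
      (fun x hx => h.inner_velocity_tangent hx (hV x hx)) v w,
    h.inner_velocity_normal hy hΓ hJ (hV y hy) (h.inner_coordSecondFF hy v w),
    fderiv_const_smul hdu]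
  simp only [Pi.smul_apply, smul_apply, smul_eq_mul]
  rw [fderiv_fderiv_symm h.coordLamSq_smooth h.isOpen hy w v]
  ring

end IsHyperkahlerPatch

/-! ### Tensors and differentials in charts -/

section Charts

variable {n : ℕ} {N : Type*} [TopologicalSpace N] [ChartedSpace (Euc n) N]
  [IsManifold (𝓡 n) ∞ N] {q x : N} {y : Euc n}

/-- The differential of the inverse of the chart at `q`, at the point with image `x`: it sends a
vector of components to the tangent vector with these components in the coordinate frame. -/
abbrev frameAt (q x : N) : Euc n →L[ℝ] TangentSpace (𝓡 n) x :=
  (trivializationAt (Euc n) (TangentSpace (𝓡 n)) q).symmL ℝ x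

/-- The differential of the chart at `q`, at `x`: the components of a tangent vector in the
coordinate frame. -/
abbrev coframeAt (q x : N) : TangentSpace (𝓡 n) x →L[ℝ] Euc n :=
  (trivializationAt (Euc n) (TangentSpace (𝓡 n)) q).continuousLinearMapAt ℝ x

lemma mem_baseSet_of_mem_source (hx : x ∈ (extChartAt (𝓡 n) q).source) :
    x ∈ (trivializationAt (Euc n) (TangentSpace (𝓡 n)) q).baseSet := by
  rw [TangentBundle.trivializationAt_baseSet]
  simpa using hx

lemma frameAt_coframeAt (hx : x ∈ (extChartAt (𝓡 n) q).source) (v : TangentSpace (𝓡 n) x) :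
    frameAt q x (coframeAt q x v) = v :=
  Trivialization.symmL_continuousLinearMapAt _ (mem_baseSet_of_mem_source hx) v

lemma coframeAt_frameAt (hx : x ∈ (extChartAt (𝓡 n) q).source) (v : Euc n) :
    coframeAt q x (frameAt q x v) = v :=
  Trivialization.continuousLinearMapAt_symmL _ (mem_baseSet_of_mem_source hx) v

lemma frameAt_injective (hx : x ∈ (extChartAt (𝓡 n) q).source) :
    Function.Injective (frameAt (n := n) q x) :=
  Function.LeftInverse.injective (coframeAt_frameAt hx)

lemma frameAt_self (q : N) (v : Euc n) : frameAt q q v = v := by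
  rw [frameAt, TangentBundle.symmL_trivializationAt_eq_core (mem_chart_source _ q)]
  exact (tangentBundleCore (𝓡 n) N).coordChange_self (achart (Euc n) q) q (mem_chart_source _ q) v

lemma coframeAt_self (q : N) (v : TangentSpace (𝓡 n) q) : coframeAt q q v = v := by
  rw [coframeAt, TangentBundle.continuousLinearMapAt_trivializationAt_eq_core
    (mem_chart_source _ q)]
  exact (tangentBundleCore (𝓡 n) N).coordChange_self (achart (Euc n) q) q (mem_chart_source _ q) v

lemma chartForm_apply (b : ∀ x : N, TangentSpace (𝓡 n) x →L[ℝ] TangentSpace (𝓡 n) x →L[ℝ] ℝ)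
    (hx : x ∈ (extChartAt (𝓡 n) q).source) (v w : Euc n) :
    chartForm b q (extChartAt (𝓡 n) q x) v w = b x (frameAt q x v) (frameAt q x w) := by
  simp only [chartForm]
  rw [(extChartAt (𝓡 n) q).left_inv hx]
  rfl

lemma chartEnd_apply (A : ∀ x : N, TangentSpace (𝓡 n) x →L[ℝ] TangentSpace (𝓡 n) x)
    (hx : x ∈ (extChartAt (𝓡 n) q).source) (v : Euc n) :
    chartEnd A q (extChartAt (𝓡 n) q x) v = coframeAt q x (A x (frameAt q x v)) := by
  simp only [chartEnd]
  rw [(extChartAt (𝓡 n) q).left_inv hx]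
  rfl

lemma chartForm_self (b : ∀ x : N, TangentSpace (𝓡 n) x →L[ℝ] TangentSpace (𝓡 n) x →L[ℝ] ℝ)
    (q : N) : chartForm b q (extChartAt (𝓡 n) q q) = b q := by
  ext v w
  rw [chartForm_apply b (mem_extChartAt_source q), frameAt_self, frameAt_self]
  rfl

lemma chartEnd_self (A : ∀ x : N, TangentSpace (𝓡 n) x →L[ℝ] TangentSpace (𝓡 n) x) (q : N) :
    chartEnd A q (extChartAt (𝓡 n) q q) = A q := by
  refine ContinuousLinearMap.ext fun v => ?_
  rw [chartEnd_apply A (mem_extChartAt_source q), frameAt_self, coframeAt_self]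
  rfl

lemma contMDiffOn_frameAt (q : N) (v : Euc n) :
    ContMDiffOn (𝓡 n) ((𝓡 n).prod 𝓘(ℝ, Euc n)) ∞
      (fun x => TotalSpace.mk' (Euc n) (E := (TangentSpace (𝓡 n) : N → Type)) x (frameAt q x v))
      (extChartAt (𝓡 n) q).source := by
  intro x hx
  have frame_smooth := ((trivializationAt (Euc n)
    (TangentSpace (𝓡 n) : N → Type) q).contMDiffOn_symmL (𝕜 := ℝ) (IB := 𝓡 n) (n := ∞) x
      (mem_baseSet_of_mem_source hx)).mono
    fun z (hz : z ∈ (extChartAt (𝓡 n) q).source) => mem_baseSet_of_mem_source hz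
  have const_smooth : ContMDiffWithinAt (𝓡 n) ((𝓡 n).prod 𝓘(ℝ, Euc n)) ∞
      (fun x => TotalSpace.mk' (Euc n) (E := Bundle.Trivial N (Euc n)) x v)
      (extChartAt (𝓡 n) q).source x :=
    contMDiffWithinAt_totalSpace.2 ⟨contMDiffWithinAt_id, contMDiffWithinAt_const⟩
  exact ContMDiffWithinAt.clm_bundle_apply (E₁ := Bundle.Trivial N (Euc n)) (F₁ := Euc n)
    (v := fun _ => v) frame_smooth const_smooth

lemma contDiffOn_comp_chart_symm {E : Type*} [NormedAddCommGroup E] [NormedSpace ℝ E] {u : N → E}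
    (hu : ContMDiffOn (𝓡 n) 𝓘(ℝ, E) ∞ u (extChartAt (𝓡 n) q).source) :
    ContDiffOn ℝ ∞ (fun y => u ((extChartAt (𝓡 n) q).symm y)) (extChartAt (𝓡 n) q).target :=
  contMDiffOn_iff_contDiffOn.1 <|
    hu.comp (contMDiffOn_extChartAt_symm q) fun _ hy => (extChartAt (𝓡 n) q).map_target hy

lemma contDiffOn_chartForm
    {b : ∀ x : N, TangentSpace (𝓡 n) x →L[ℝ] TangentSpace (𝓡 n) x →L[ℝ] ℝ}
    (hb : ContMDiff (𝓡 n) ((𝓡 n).prod 𝓘(ℝ, Euc n →L[ℝ] Euc n →L[ℝ] ℝ)) ∞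
      (fun x => TotalSpace.mk' (Euc n →L[ℝ] Euc n →L[ℝ] ℝ)
        (E := fun x : N => TangentSpace (𝓡 n) x →L[ℝ] TangentSpace (𝓡 n) x →L[ℝ] ℝ) x (b x)))
    (q : N) : ContDiffOn ℝ ∞ (chartForm b q) (extChartAt (𝓡 n) q).target := by
  simp only [contDiffOn_clm_apply]
  intro v w
  refine contDiffOn_comp_chart_symm (u := fun x => b x (frameAt q x v) (frameAt q x w))
    fun x hx => ?_
  have component_smooth : ContMDiffWithinAt (𝓡 n) ((𝓡 n).prod 𝓘(ℝ, ℝ)) ∞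
      (fun x => TotalSpace.mk' ℝ (E := Bundle.Trivial N ℝ) x
        (b x (frameAt q x v) (frameAt q x w))) (extChartAt (𝓡 n) q).source x :=
    ContMDiffWithinAt.clm_bundle_apply₂ (F₁ := Euc n) (F₂ := Euc n)
      (hb x).contMDiffWithinAt (contMDiffOn_frameAt q v x hx) (contMDiffOn_frameAt q w x hx)
  exact (contMDiffWithinAt_totalSpace.1 component_smooth).2

lemma contDiffOn_chartEnd {A : ∀ x : N, TangentSpace (𝓡 n) x →L[ℝ] TangentSpace (𝓡 n) x}
    (hA : ContMDiff (𝓡 n) ((𝓡 n).prod 𝓘(ℝ, Euc n →L[ℝ] Euc n)) ∞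
      (fun x => TotalSpace.mk' (Euc n →L[ℝ] Euc n)
        (E := fun x : N => TangentSpace (𝓡 n) x →L[ℝ] TangentSpace (𝓡 n) x) x (A x)))
    (q : N) : ContDiffOn ℝ ∞ (chartEnd A q) (extChartAt (𝓡 n) q).target := by
  rw [contDiffOn_clm_apply]
  intro v
  refine contDiffOn_comp_chart_symm (u := fun x => coframeAt q x (A x (frameAt q x v)))
    fun x hx => ?_
  have column_smooth : ContMDiffWithinAt (𝓡 n) ((𝓡 n).prod 𝓘(ℝ, Euc n)) ∞
      (fun x => TotalSpace.mk' (Euc n) (E := (TangentSpace (𝓡 n) : N → Type)) x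
        (A x (frameAt q x v))) (extChartAt (𝓡 n) q).source x :=
    ContMDiffWithinAt.clm_bundle_apply (F₁ := Euc n)
      (hA x).contMDiffWithinAt (contMDiffOn_frameAt q v x hx)
  have coframeAt_eq : ∀ z ∈ (extChartAt (𝓡 n) q).source, ∀ w : TangentSpace (𝓡 n) z,
      coframeAt q z w = (trivializationAt (Euc n) (TangentSpace (𝓡 n) : N → Type) q ⟨z, w⟩).2 :=
    fun z hz => congrFun (Trivialization.coe_linearMapAt_of_mem _ (mem_baseSet_of_mem_source hz))
  rw [(trivializationAt (Euc n) (TangentSpace (𝓡 n) : N → Type) q).contMDiffWithinAt_iff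
    (by exact mem_baseSet_of_mem_source hx)] at column_smooth
  exact column_smooth.2.congr (fun z hz => coframeAt_eq z hz _) (coframeAt_eq x hx _)

lemma mdifferentiableAt_extChartAt_symm (hy : y ∈ (extChartAt (𝓡 n) q).target) :
    MDifferentiableAt 𝓘(ℝ, Euc n) (𝓡 n) (extChartAt (𝓡 n) q).symm y :=
  (((contMDiffOn_extChartAt_symm (I := 𝓡 n) (n := 1) q) y hy).contMDiffAt
    ((isOpen_extChartAt_target q).mem_nhds hy)).mdifferentiableAt one_ne_zero

lemma frameAt_eq_mfderiv (hy : y ∈ (extChartAt (𝓡 n) q).target) :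
    frameAt q ((extChartAt (𝓡 n) q).symm y)
      = mfderiv 𝓘(ℝ, Euc n) (𝓡 n) (extChartAt (𝓡 n) q).symm y := by
  rw [frameAt, TangentBundle.symmL_trivializationAt (by
    simpa using (extChartAt (𝓡 n) q).map_target hy), (extChartAt (𝓡 n) q).right_inv hy,
    ModelWithCorners.range_eq_univ, mfderivWithin_univ]

lemma mfderiv_frameAt {E : Type*} [NormedAddCommGroup E] [NormedSpace ℝ E] {u : N → E}
    (hy : y ∈ (extChartAt (𝓡 n) q).target)
    (hu : MDifferentiableAt (𝓡 n) 𝓘(ℝ, E) u ((extChartAt (𝓡 n) q).symm y)) (v : Euc n) :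
    mfderiv (𝓡 n) 𝓘(ℝ, E) u ((extChartAt (𝓡 n) q).symm y)
        (frameAt q ((extChartAt (𝓡 n) q).symm y) v)
      = fderiv ℝ (fun y => u ((extChartAt (𝓡 n) q).symm y)) y v := by
  rw [frameAt_eq_mfderiv hy, ← mfderiv_eq_fderiv]
  have chain := mfderiv_comp y hu (mdifferentiableAt_extChartAt_symm hy)
  exact (congrArg (fun L : Euc n →L[ℝ] E => L v) chain).symm

lemma mdifferentiableAt_of_comp_chart_symm {E : Type*} [NormedAddCommGroup E] [NormedSpace ℝ E]
    {u : N → E} {φ : Euc n → E} (hy : y ∈ (extChartAt (𝓡 n) q).target)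
    (hφ : DifferentiableAt ℝ φ y)
    (hu : (fun y => u ((extChartAt (𝓡 n) q).symm y)) =ᶠ[nhds y] φ) :
    MDifferentiableAt (𝓡 n) 𝓘(ℝ, E) u ((extChartAt (𝓡 n) q).symm y) := by
  have hx := (extChartAt (𝓡 n) q).map_target hy
  have apply_symm := (extChartAt (𝓡 n) q).right_inv hy
  have comp_chart : MDifferentiableAt (𝓡 n) 𝓘(ℝ, E) (fun x => φ (extChartAt (𝓡 n) q x))
      ((extChartAt (𝓡 n) q).symm y) :=
    MDifferentiableAt.comp _ (by rw [apply_symm]; exact hφ.mdifferentiableAt)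
      (mdifferentiableAt_extChartAt (by simpa using hx))
  have chart_tendsto : Filter.Tendsto (extChartAt (𝓡 n) q)
      (nhds ((extChartAt (𝓡 n) q).symm y)) (nhds y) := by
    simpa only [apply_symm] using (continuousAt_extChartAt' (I := 𝓡 n) hx).tendsto
  refine comp_chart.congr_of_eventuallyEq ?_
  filter_upwards [chart_tendsto hu, extChartAt_source_mem_nhds' (I := 𝓡 n) hx] with x hux hxs
  have hux : u ((extChartAt (𝓡 n) q).symm (extChartAt (𝓡 n) q x)) = φ (extChartAt (𝓡 n) q x) := hux
  rwa [(extChartAt (𝓡 n) q).left_inv hxs] at hux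

lemma mfderiv_frameAt_of_eventuallyEq {E : Type*} [NormedAddCommGroup E] [NormedSpace ℝ E]
    {u : N → E} {φ : Euc n → E} (hy : y ∈ (extChartAt (𝓡 n) q).target)
    (hφ : DifferentiableAt ℝ φ y)
    (hu : (fun y => u ((extChartAt (𝓡 n) q).symm y)) =ᶠ[nhds y] φ) (v : Euc n) :
    mfderiv (𝓡 n) 𝓘(ℝ, E) u ((extChartAt (𝓡 n) q).symm y)
        (frameAt q ((extChartAt (𝓡 n) q).symm y) v) = fderiv ℝ φ y v := by
  rw [mfderiv_frameAt hy (mdifferentiableAt_of_comp_chart_symm hy hφ hu), hu.fderiv_eq]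

lemma coframeAt_mfderiv_frameAt {m : ℕ} {N' : Type*} [TopologicalSpace N'] [ChartedSpace (Euc m) N']
    [IsManifold (𝓡 m) ∞ N'] {f : N → N'} {q' : N'} (hy : y ∈ (extChartAt (𝓡 n) q).target)
    (hf : MDifferentiableAt (𝓡 n) (𝓡 m) f ((extChartAt (𝓡 n) q).symm y))
    (hq' : f ((extChartAt (𝓡 n) q).symm y) ∈ (extChartAt (𝓡 m) q').source) (v : Euc n) :
    coframeAt q' (f ((extChartAt (𝓡 n) q).symm y))
        (mfderiv (𝓡 n) (𝓡 m) f ((extChartAt (𝓡 n) q).symm y)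
          (frameAt q ((extChartAt (𝓡 n) q).symm y) v))
      = fderiv ℝ (fun y => extChartAt (𝓡 m) q' (f ((extChartAt (𝓡 n) q).symm y))) y v := by
  have hs : f ((extChartAt (𝓡 n) q).symm y) ∈ (chartAt (Euc m) q').source := by simpa using hq'
  have chart_diff : MDifferentiableAt (𝓡 m) 𝓘(ℝ, Euc m) (extChartAt (𝓡 m) q')
      (f ((extChartAt (𝓡 n) q).symm y)) := mdifferentiableAt_extChartAt hs
  rw [coframeAt, TangentBundle.continuousLinearMapAt_trivializationAt hs,
    ← mfderiv_frameAt (u := fun x => extChartAt (𝓡 m) q' (f x)) hy (chart_diff.comp _ hf)]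
  have chain := mfderiv_comp ((extChartAt (𝓡 n) q).symm y) chart_diff hf
  exact (congrArg (fun L : Euc n →L[ℝ] Euc m =>
    L (frameAt q ((extChartAt (𝓡 n) q).symm y) v)) chain).symm

end Charts

/-! ### Immersed surfaces in charts -/

section AreaForm

variable {S : Type*} [TopologicalSpace S] [ChartedSpace (Euc 2) S] [IsManifold (𝓡 2) ∞ S]
  {x₀ x : S} {y : Euc 2}

lemma AreaForm.apply_eq (ρ : AreaForm S) (x : S) (v w : Euc 2) :
    ρ.form x v w = wedge v w * ρ.form x (basisVec 2 0) (basisVec 2 1) :=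
  alternating_apply (β := ρ.form x) (ρ.alternating x) v w

lemma AreaForm.basis_ne_zero (ρ : AreaForm S) (x : S) :
    ρ.form x (basisVec 2 0) (basisVec 2 1) ≠ 0 := by
  intro hzero
  refine ρ.nonvanishing x (ContinuousLinearMap.ext fun (v : Euc 2) =>
    ContinuousLinearMap.ext fun (w : Euc 2) => ?_)
  exact (ρ.apply_eq x v w).trans (by rw [hzero, mul_zero]; rfl)

/-- The coefficient of `ρ` on `dx⁰ ∧ dx¹` in the chart at `x₀`. -/
def coordArea (ρ : AreaForm S) (x₀ : S) (y : Euc 2) : ℝ :=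
  chartForm ρ.form x₀ y (basisVec 2 0) (basisVec 2 1)

lemma coordArea_eq (ρ : AreaForm S) (hx : (extChartAt (𝓡 2) x₀).symm y = x) :
    coordArea ρ x₀ y = ρ.form x (frameAt x₀ x (basisVec 2 0)) (frameAt x₀ x (basisVec 2 1)) := by
  subst hx
  rfl

lemma wedge_frame_ne_zero (hx : x ∈ (extChartAt (𝓡 2) x₀).source) :
    wedge (frameAt x₀ x (basisVec 2 0)) (frameAt x₀ x (basisVec 2 1)) ≠ 0 :=
  wedge_ne_zero (D := frameAt x₀ x) (frameAt_injective hx)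

lemma coordArea_ne_zero (ρ : AreaForm S) (hy : y ∈ (extChartAt (𝓡 2) x₀).target) :
    coordArea ρ x₀ y ≠ 0 := by
  rw [coordArea_eq ρ rfl]
  exact (ρ.apply_eq _ _ _).trans_ne
    (mul_ne_zero (wedge_frame_ne_zero ((extChartAt (𝓡 2) x₀).map_target hy)) (ρ.basis_ne_zero _))

end AreaForm

section Immersed

variable {S M : Type*} [TopologicalSpace S] [ChartedSpace (Euc 2) S]
  [TopologicalSpace M] [ChartedSpace (Euc 4) M]

/-- The map `g` in the charts at `x₀` and `q`. -/
def coordMap (g : S → M) (x₀ : S) (q : M) (y : Euc 2) : Euc 4 :=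
  extChartAt (𝓡 4) q (g ((extChartAt (𝓡 2) x₀).symm y))

lemma coordMap_base (g : S → M) (x₀ : S) :
    coordMap g x₀ (g x₀) (extChartAt (𝓡 2) x₀ x₀) = extChartAt (𝓡 4) (g x₀) (g x₀) := by
  rw [coordMap, extChartAt_to_inv]

/-- `g` is an immersion, and `U` is a neighbourhood of `x₀`, in the chart at `x₀`, that `g` maps to
the chart at `q`. -/
structure IsChartPatch (g : S → M) (x₀ : S) (q : M) (U : Set (Euc 2)) : Prop where
  contMDiff : ContMDiff (𝓡 2) (𝓡 4) ∞ g
  injective : ∀ x, Function.Injective (mfderiv (𝓡 2) (𝓡 4) g x)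
  isOpen : IsOpen U
  mem_base : extChartAt (𝓡 2) x₀ x₀ ∈ U
  subset_target : U ⊆ (extChartAt (𝓡 2) x₀).target
  mapsTo_source : ∀ y ∈ U, g ((extChartAt (𝓡 2) x₀).symm y) ∈ (extChartAt (𝓡 4) q).source

namespace IsChartPatch

variable {g : S → M} {x₀ x : S} {q : M} {U : Set (Euc 2)} {y : Euc 2}

lemma mem_source (h : IsChartPatch g x₀ q U) (hy : y ∈ U)
    (hx : (extChartAt (𝓡 2) x₀).symm y = x) : x ∈ (extChartAt (𝓡 2) x₀).source :=
  hx ▸ (extChartAt (𝓡 2) x₀).map_target (h.subset_target hy)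

lemma mem_nhds (h : IsChartPatch g x₀ q U) : U ∈ nhds (extChartAt (𝓡 2) x₀ x₀) :=
  h.isOpen.mem_nhds h.mem_base

end IsChartPatch

section Ambient

variable [IsManifold (𝓡 4) ∞ M]

lemma HyperKahler.isInner (𝓗 : HyperKahler M) (z : M) : IsInner (𝓗.metric.inner z) :=
  ⟨𝓗.metric.symm z, 𝓗.metric.pos z⟩

lemma HyperKahler.isQuaternionic (𝓗 : HyperKahler M) (z : M) :
    IsQuaternionic (𝓗.metric.inner z) fun a => 𝓗.cplx a z :=
  { 𝓗.isInner z with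
    sq := fun a => 𝓗.sq a z
    quat := 𝓗.quat z
    orth := fun a => 𝓗.orthogonal a z }

lemma HyperKahler.isQuaternionic_chart (𝓗 : HyperKahler M) {q : M} {z : Euc 4}
    (hz : z ∈ (extChartAt (𝓡 4) q).target) :
    IsQuaternionic (chartForm 𝓗.metric.inner q z) fun a => chartEnd (𝓗.cplx a) q z := by
  obtain ⟨x, hx, rfl⟩ : ∃ x ∈ (extChartAt (𝓡 4) q).source, extChartAt (𝓡 4) q x = z :=
    ⟨_, (extChartAt (𝓡 4) q).map_target hz, (extChartAt (𝓡 4) q).right_inv hz⟩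
  constructor
  · constructor <;> intro v
    · intro w
      rw [chartForm_apply _ hx, chartForm_apply _ hx, 𝓗.metric.symm]
    · intro hv
      rw [chartForm_apply _ hx]
      exact 𝓗.metric.pos x _ fun h => hv (frameAt_injective hx (h.trans (map_zero _).symm))
  · intro a v
    rw [chartEnd_apply _ hx, chartEnd_apply _ hx, frameAt_coframeAt hx, 𝓗.sq, map_neg,
      coframeAt_frameAt hx]
  · intro v
    rw [chartEnd_apply _ hx, chartEnd_apply _ hx, chartEnd_apply _ hx, frameAt_coframeAt hx,
      𝓗.quat]
  · intro a v w
    rw [chartForm_apply _ hx, chartForm_apply _ hx, chartEnd_apply _ hx, chartEnd_apply _ hx,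
      frameAt_coframeAt hx, frameAt_coframeAt hx, 𝓗.orthogonal]

lemma HyperKahler.metric_base (𝓗 : HyperKahler M) (g : S → M) (x₀ : S) :
    chartForm 𝓗.metric.inner (g x₀) (coordMap g x₀ (g x₀) (extChartAt (𝓡 2) x₀ x₀))
      = 𝓗.metric.inner (g x₀) := by
  rw [coordMap_base, chartForm_self]

lemma isInner_inducedMetric (𝓗 : HyperKahler M) {g : S → M} {x : S}
    (hg : Function.Injective (mfderiv (𝓡 2) (𝓡 4) g x)) : IsInner (inducedMetric 𝓗 g x) :=
  (𝓗.isInner (g x)).pull hg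

variable [IsManifold (𝓡 2) ∞ S]

lemma inducedArea_eq (𝓗 : HyperKahler M) (ρ : AreaForm S) {g : S → M} {x : S}
    (hg : Function.Injective (mfderiv (𝓡 2) (𝓡 4) g x)) (v w : Euc 2) :
    inducedArea 𝓗 ρ g x v w = wedge v w *
      ((SignType.sign (ρ.form x (basisVec 2 0) (basisVec 2 1)) : ℝ)
        * √(gram (inducedMetric 𝓗 g x)).det) := by
  have hgram := (isInner_inducedMetric 𝓗 hg).gram_apply_eq v w
  refine (congrArg₂ (fun a b : ℝ => (SignType.sign a : ℝ) * √b) (ρ.apply_eq x v w) hgram).trans ?_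
  rw [sign_mul, Real.sqrt_mul (sq_nonneg _), Real.sqrt_sq_eq_abs, SignType.coe_mul,
    mul_mul_mul_comm, sign_mul_abs]

lemma lam_eq (𝓗 : HyperKahler M) (ρ : AreaForm S) {g : S → M} {x : S}
    (hg : Function.Injective (mfderiv (𝓡 2) (𝓡 4) g x)) :
    lam 𝓗 ρ g x
      = √(gram (inducedMetric 𝓗 g x)).det / |ρ.form x (basisVec 2 0) (basisVec 2 1)| := by
  have hdet := (isInner_inducedMetric 𝓗 hg).det_gram_eq
  have hlam : lam 𝓗 ρ g x = (SignType.sign (ρ.form x (basisVec 2 0) (basisVec 2 1)) : ℝ)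
      * √(gram (inducedMetric 𝓗 g x)).det / ρ.form x (basisVec 2 0) (basisVec 2 1) := by
    rw [hdet]
    rfl
  rcases lt_or_gt_of_ne (ρ.basis_ne_zero x) with hneg | hpos
  · rw [hlam, sign_neg hneg, abs_of_neg hneg, div_neg, SignType.coe_neg_one, neg_one_mul, neg_div]
  · rw [hlam, sign_pos hpos, abs_of_pos hpos, SignType.coe_one, one_mul]

lemma lam_nonneg (𝓗 : HyperKahler M) (ρ : AreaForm S) {g : S → M} {x : S}
    (hg : Function.Injective (mfderiv (𝓡 2) (𝓡 4) g x)) : 0 ≤ lam 𝓗 ρ g x :=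
  (lam_eq 𝓗 ρ hg).symm ▸ div_nonneg (Real.sqrt_nonneg _) (abs_nonneg _)

lemma lam_sq_eq (𝓗 : HyperKahler M) (ρ : AreaForm S) {g : S → M} {x : S}
    (hg : Function.Injective (mfderiv (𝓡 2) (𝓡 4) g x)) :
    lam 𝓗 ρ g x ^ 2
      = (gram (inducedMetric 𝓗 g x)).det / ρ.form x (basisVec 2 0) (basisVec 2 1) ^ 2 := by
  rw [lam_eq 𝓗 ρ hg, div_pow, sq_abs, Real.sq_sqrt (isInner_inducedMetric 𝓗 hg).det_gram_pos.le]

lemma momentFn_eq (𝓗 : HyperKahler M) (ρ : AreaForm S) (g : S → M) (a : Fin 3) (x : S)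
    {v w : Euc 2} (hvw : wedge v w ≠ 0) :
    momentFn 𝓗 ρ g a x = kahlerForm 𝓗 a (g x) (mfderiv (𝓡 2) (𝓡 4) g x v)
      (mfderiv (𝓡 2) (𝓡 4) g x w) / ρ.form x v w := by
  have hω := alternating_apply (β := pullForm ((𝓗.metric.inner (g x)).comp (𝓗.cplx a (g x)))
    (mfderiv (𝓡 2) (𝓡 4) g x)) (fun v => (𝓗.isQuaternionic (g x)).apply_self a _) v w
  refine Eq.trans ?_ (congrArg₂ (fun a b : ℝ => a / b) hω (ρ.apply_eq x v w)).symm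
  exact (mul_div_mul_left _ _ hvw).symm

namespace IsChartPatch

variable {g : S → M} {x₀ x : S} {q : M} {U : Set (Euc 2)} {y : Euc 2}

lemma mfderiv_frame (h : IsChartPatch g x₀ q U) (hy : y ∈ U)
    (hx : (extChartAt (𝓡 2) x₀).symm y = x) (v : Euc 2) :
    mfderiv (𝓡 2) (𝓡 4) g x (frameAt x₀ x v)
      = frameAt q (g x) (fderiv ℝ (coordMap g x₀ q) y v) := by
  subst hx
  have hcomp := coframeAt_mfderiv_frameAt (h.subset_target hy)
    (h.contMDiff.mdifferentiableAt (by simp)) (h.mapsTo_source y hy) v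
  exact (frameAt_coframeAt (h.mapsTo_source y hy) _).symm.trans (congrArg _ hcomp)

lemma coordMap_smooth (h : IsChartPatch g x₀ q U) : ContDiffOn ℝ ∞ (coordMap g x₀ q) U := by
  rw [← contMDiffOn_iff_contDiffOn]
  refine (contMDiffOn_extChartAt (I := 𝓡 4) (x := q)).comp (h.contMDiff.comp_contMDiffOn
    ((contMDiffOn_extChartAt_symm x₀).mono h.subset_target)) fun y hy => ?_
  simpa only [mem_preimage, extChartAt_source] using h.mapsTo_source y hy

lemma isImmersedPatch (h : IsChartPatch g x₀ q U) (𝓗 : HyperKahler M) :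
    IsImmersedPatch (chartForm 𝓗.metric.inner q) (extChartAt (𝓡 4) q).target U
      (coordMap g x₀ q) where
  isMetricOn :=
    { isOpen := isOpen_extChartAt_target q
      smooth := contDiffOn_chartForm 𝓗.metric.contMDiff q
      isInner := fun _ hz => (𝓗.isQuaternionic_chart hz).toIsInner }
  isOpen := h.isOpen
  smooth := h.coordMap_smooth
  mapsTo y hy := (extChartAt (𝓡 4) q).map_source (h.mapsTo_source y hy)
  injective y hy v w hvw := by
    refine frameAt_injective (h.mem_source hy rfl) (h.injective _ ?_)
    rw [h.mfderiv_frame hy rfl, h.mfderiv_frame hy rfl, hvw]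

lemma isHyperkahlerPatch (h : IsChartPatch g x₀ q U) (𝓗 : HyperKahler M) (ρ : AreaForm S) :
    IsHyperkahlerPatch (chartForm 𝓗.metric.inner q) (fun a => chartEnd (𝓗.cplx a) q)
      (extChartAt (𝓡 4) q).target (coordArea ρ x₀) U (coordMap g x₀ q) :=
  { h.isImmersedPatch 𝓗 with
    quaternionic := fun _ hz => 𝓗.isQuaternionic_chart hz
    cplx_smooth := fun a => contDiffOn_chartEnd (𝓗.smooth a) q
    area_smooth := (((contDiffOn_chartForm ρ.smooth x₀).mono h.subset_target).clm_apply
      contDiffOn_const).clm_apply contDiffOn_const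
    area_ne_zero := fun _ hy => coordArea_ne_zero ρ (h.subset_target hy) }

lemma inducedMetric_frame (h : IsChartPatch g x₀ q U) (𝓗 : HyperKahler M) (hy : y ∈ U)
    (hx : (extChartAt (𝓡 2) x₀).symm y = x) (v w : Euc 2) :
    inducedMetric 𝓗 g x (frameAt x₀ x v) (frameAt x₀ x w)
      = coordMetric (chartForm 𝓗.metric.inner q) (coordMap g x₀ q) y v w := by
  subst hx
  change 𝓗.metric.inner _ (mfderiv (𝓡 2) (𝓡 4) g _ _) (mfderiv (𝓡 2) (𝓡 4) g _ _) = _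
  rw [h.mfderiv_frame hy rfl, h.mfderiv_frame hy rfl]
  exact (chartForm_apply 𝓗.metric.inner (h.mapsTo_source y hy) _ _).symm

lemma lam_sq (h : IsChartPatch g x₀ q U) (𝓗 : HyperKahler M) (ρ : AreaForm S) (hy : y ∈ U)
    (hx : (extChartAt (𝓡 2) x₀).symm y = x) :
    lam 𝓗 ρ g x ^ 2
      = coordLamSq (chartForm 𝓗.metric.inner q) (coordArea ρ x₀) (coordMap g x₀ q) y := by
  have hdet := ((h.isImmersedPatch 𝓗).isMetricOn_coordMetric.isInner y hy).det_gram_eq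
  simp only [← h.inducedMetric_frame 𝓗 hy hx] at hdet
  have hgram := (isInner_inducedMetric 𝓗 (h.injective x)).gram_apply_eq
    (frameAt x₀ x (basisVec 2 0)) (frameAt x₀ x (basisVec 2 1))
  have harea : coordArea ρ x₀ y = wedge (frameAt x₀ x (basisVec 2 0)) (frameAt x₀ x (basisVec 2 1))
      * ρ.form x (basisVec 2 0) (basisVec 2 1) :=
    (coordArea_eq ρ hx).trans (ρ.apply_eq x _ _)
  rw [lam_sq_eq 𝓗 ρ (h.injective x), coordLamSq, hdet.trans hgram, harea, mul_pow,
    mul_div_mul_left _ _ (pow_ne_zero 2 (wedge_frame_ne_zero (h.mem_source hy hx)))]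

lemma momentFn_eq (h : IsChartPatch g x₀ q U) (𝓗 : HyperKahler M) (ρ : AreaForm S) (hy : y ∈ U)
    (hx : (extChartAt (𝓡 2) x₀).symm y = x) (a : Fin 3) :
    momentFn 𝓗 ρ g a x = coordMoment (chartForm 𝓗.metric.inner q) (chartEnd (𝓗.cplx a) q)
      (coordArea ρ x₀) (coordMap g x₀ q) y := by
  rw [HFlow.momentFn_eq 𝓗 ρ g a x (wedge_frame_ne_zero (h.mem_source hy hx)), ← coordArea_eq ρ hx,
    h.mfderiv_frame hy hx, h.mfderiv_frame hy hx]
  subst hx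
  have hsource := h.mapsTo_source y hy
  rw [coordMoment, coordKahler, coordMap, chartForm_apply _ hsource,
    chartEnd_apply _ hsource, frameAt_coframeAt hsource]
  rfl

end IsChartPatch

end Ambient

end Immersed

lemma IsLeviCivitaAt.congr {n : ℕ} {G G' : Euc n → BilinForm n} {z : Euc n}
    {Γ : Euc n → Euc n → Euc n} (h : IsLeviCivitaAt G z Γ) (hG : G =ᶠ[nhds z] G') :
    IsLeviCivitaAt G' z Γ := fun v w u => by
  rw [← hG.eq_of_nhds, ← hG.fderiv_eq]
  exact h v w u

lemma isLeviCivitaAt_christoffel {n : ℕ} {N : Type*} [TopologicalSpace N] [ChartedSpace (Euc n) N]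
    [IsManifold (𝓡 n) ∞ N] {b : ∀ x : N, TangentSpace (𝓡 n) x →L[ℝ] TangentSpace (𝓡 n) x →L[ℝ] ℝ}
    {q : N} (hb : IsInner (b q)) :
    IsLeviCivitaAt (chartForm b q) (extChartAt (𝓡 n) q q) (christoffel b q) := by
  have hb' : IsInner (chartForm b q (extChartAt (𝓡 n) q q)) := by
    rw [chartForm_self]
    exact hb
  have hΓ := hb'.isLeviCivitaAt_metricTrace
  rw [chartForm_self] at hΓ
  exact hΓ

section BasePoint

variable {S M : Type*} [TopologicalSpace S] [ChartedSpace (Euc 2) S] [IsManifold (𝓡 2) ∞ S]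
  [TopologicalSpace M] [ChartedSpace (Euc 4) M] [IsManifold (𝓡 4) ∞ M]

lemma HyperKahler.isParallelAt (𝓗 : HyperKahler M) (a : Fin 3) (q : M) :
    IsParallelAt (chartEnd (𝓗.cplx a) q) (extChartAt (𝓡 4) q q) (christoffel 𝓗.metric.inner q) :=
  fun v w => by
    rw [chartEnd_self]
    exact 𝓗.parallel a q v w

namespace IsChartPatch

variable {g : S → M} {x₀ : S} {q : M} {U : Set (Euc 2)}

lemma chartForm_inducedMetric (h : IsChartPatch g x₀ q U) (𝓗 : HyperKahler M) :
    chartForm (inducedMetric 𝓗 g) x₀ =ᶠ[nhds (extChartAt (𝓡 2) x₀ x₀)]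
      coordMetric (chartForm 𝓗.metric.inner q) (coordMap g x₀ q) := by
  filter_upwards [h.mem_nhds] with y hy
  exact ContinuousLinearMap.ext fun v => ContinuousLinearMap.ext fun w =>
    h.inducedMetric_frame 𝓗 hy rfl v w

lemma inducedMetric_base (h : IsChartPatch g x₀ q U) (𝓗 : HyperKahler M) :
    inducedMetric 𝓗 g x₀ = coordMetric (chartForm 𝓗.metric.inner q) (coordMap g x₀ q)
      (extChartAt (𝓡 2) x₀ x₀) :=
  (chartForm_self _ x₀).symm.trans (h.chartForm_inducedMetric 𝓗).eq_of_nhds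

lemma isLeviCivitaAt_inducedMetric (h : IsChartPatch g x₀ q U) (𝓗 : HyperKahler M) :
    IsLeviCivitaAt (coordMetric (chartForm 𝓗.metric.inner q) (coordMap g x₀ q))
      (extChartAt (𝓡 2) x₀ x₀) (christoffel (inducedMetric 𝓗 g) x₀) :=
  (isLeviCivitaAt_christoffel (isInner_inducedMetric 𝓗 (h.injective x₀))).congr
    (h.chartForm_inducedMetric 𝓗)

lemma hess_lam_sq (h : IsChartPatch g x₀ q U) (𝓗 : HyperKahler M) (ρ : AreaForm S) (v w : Euc 2) :
    hess (inducedMetric 𝓗 g) (fun x => lam 𝓗 ρ g x ^ 2) x₀ v w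
      = fderiv ℝ (fderiv ℝ (coordLamSq (chartForm 𝓗.metric.inner q) (coordArea ρ x₀)
          (coordMap g x₀ q))) (extChartAt (𝓡 2) x₀ x₀) v w
        - fderiv ℝ (coordLamSq (chartForm 𝓗.metric.inner q) (coordArea ρ x₀) (coordMap g x₀ q))
          (extChartAt (𝓡 2) x₀ x₀) (christoffel (inducedMetric 𝓗 g) x₀ v w) := by
  have hev : (fun x => lam 𝓗 ρ g x ^ 2) ∘ (extChartAt (𝓡 2) x₀).symm
      =ᶠ[nhds (extChartAt (𝓡 2) x₀ x₀)]
        coordLamSq (chartForm 𝓗.metric.inner q) (coordArea ρ x₀) (coordMap g x₀ q) := by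
    filter_upwards [h.mem_nhds] with y hy using h.lam_sq 𝓗 ρ hy rfl
  simp only [hess]
  rw [hev.fderiv.fderiv_eq, hev.fderiv_eq]

lemma mfderiv_base (h : IsChartPatch g x₀ (g x₀) U) (v : Euc 2) :
    mfderiv (𝓡 2) (𝓡 4) g x₀ v
      = fderiv ℝ (coordMap g x₀ (g x₀)) (extChartAt (𝓡 2) x₀ x₀) v := by
  have hframe := h.mfderiv_frame h.mem_base (extChartAt_to_inv x₀) v
  rwa [frameAt_self, frameAt_self] at hframe

lemma covDerivAlong_eq (h : IsChartPatch g x₀ (g x₀) U) (𝓗 : HyperKahler M) (v w : Euc 2) :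
    covDerivAlong 𝓗 g x₀ v w = coordCovDeriv (christoffel 𝓗.metric.inner (g x₀))
      (coordMap g x₀ (g x₀)) (extChartAt (𝓡 2) x₀ x₀) v w := by
  rw [coordCovDeriv, ← h.mfderiv_base, ← h.mfderiv_base]
  rfl

lemma secondFF_eq (h : IsChartPatch g x₀ (g x₀) U) (𝓗 : HyperKahler M) (v w : Euc 2) :
    secondFF 𝓗 g x₀ v w = coordSecondFF (chartForm 𝓗.metric.inner (g x₀))
      (christoffel 𝓗.metric.inner (g x₀)) (coordMap g x₀ (g x₀)) (extChartAt (𝓡 2) x₀ x₀) v w := by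
  have hD : mfderiv (𝓡 2) (𝓡 4) g x₀
      = fderiv ℝ (coordMap g x₀ (g x₀)) (extChartAt (𝓡 2) x₀ x₀) :=
    ContinuousLinearMap.ext h.mfderiv_base
  rw [coordSecondFF, ← h.covDerivAlong_eq 𝓗, 𝓗.metric_base, ← hD]
  rfl

lemma meanCurv_eq (h : IsChartPatch g x₀ (g x₀) U) (𝓗 : HyperKahler M) :
    meanCurv 𝓗 g x₀ = coordMeanCurv (chartForm 𝓗.metric.inner (g x₀))
      (christoffel 𝓗.metric.inner (g x₀)) (coordMap g x₀ (g x₀)) (extChartAt (𝓡 2) x₀ x₀) := by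
  rw [coordMeanCurv, ← h.inducedMetric_base 𝓗,
    ← funext fun v => funext fun w => h.secondFF_eq 𝓗 v w]
  rfl

end IsChartPatch

end BasePoint

/-! ### The flow in charts -/

lemma interior_inter_ball_nonempty {E : Type*} [NormedAddCommGroup E] [NormedSpace ℝ E] {τ : Set E}
    (hτ : Convex ℝ τ) (hτ' : (interior τ).Nonempty) {t₀ : E} (ht₀ : t₀ ∈ τ) {ε : ℝ} (hε : 0 < ε) :
    (interior (τ ∩ Metric.ball t₀ ε)).Nonempty := by
  have hclosure : t₀ ∈ closure (interior τ) := by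
    rw [hτ.closure_interior_eq_closure_of_nonempty_interior hτ']
    exact subset_closure ht₀
  rw [interior_inter, Metric.isOpen_ball.interior_eq, inter_comm]
  exact mem_closure_iff_nhds.1 hclosure _ (Metric.ball_mem_nhds t₀ hε)

lemma hasDerivWithinAt_extChartAt_comp {n : ℕ} {N : Type*} [TopologicalSpace N]
    [ChartedSpace (Euc n) N] [IsManifold (𝓡 n) ∞ N] {c : ℝ → N} {τ : Set ℝ} {t : ℝ}
    {V : TangentSpace (𝓡 n) (c t)} {q : N}
    (hc : HasMFDerivWithinAt 𝓘(ℝ, ℝ) (𝓡 n) c τ t (ContinuousLinearMap.toSpanSingleton ℝ V))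
    (hq : c t ∈ (extChartAt (𝓡 n) q).source) :
    HasDerivWithinAt (fun s => extChartAt (𝓡 n) q (c s)) (coframeAt q (c t) V) τ t := by
  rw [extChartAt_source] at hq
  have hcomp := (mdifferentiableAt_extChartAt hq).hasMFDerivAt.comp_hasMFDerivWithinAt t hc
  rw [← TangentBundle.continuousLinearMapAt_trivializationAt hq] at hcomp
  have hspan : ∀ (A : Euc n →L[ℝ] Euc n) (V : Euc n),
      A.comp (ContinuousLinearMap.toSpanSingleton ℝ V)
        = ContinuousLinearMap.toSpanSingleton ℝ (A V) := fun A V => A.comp_toSpanSingleton V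
  have hderiv : HasFDerivWithinAt (fun s => extChartAt (𝓡 n) q (c s))
      (ContinuousLinearMap.toSpanSingleton ℝ (coframeAt q (c t) V)) τ t :=
    hcomp.hasFDerivWithinAt.congr_fderiv (hspan _ _)
  exact hderiv.hasDerivWithinAt.congr_deriv (one_smul ℝ (coframeAt q (c t) V))

section Flow

variable {S M : Type*} [TopologicalSpace S] [ChartedSpace (Euc 2) S] [IsManifold (𝓡 2) ∞ S]
  [TopologicalSpace M] [ChartedSpace (Euc 4) M] [IsManifold (𝓡 4) ∞ M]
  {𝓗 : HyperKahler M} {ρ : AreaForm S} {τ : Set ℝ} {f : ℝ → S → M} {t₀ t : ℝ} {x₀ : S}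

lemma coordArea_mul_wedge (ρ : AreaForm S) {x : S} {y : Euc 2}
    (hy : y ∈ (extChartAt (𝓡 2) x₀).target) (hx : (extChartAt (𝓡 2) x₀).symm y = x)
    (ξ : TangentSpace (𝓡 2) x) (v : Euc 2) :
    coordArea ρ x₀ y * wedge (coframeAt x₀ x ξ) v = ρ.form x ξ (frameAt x₀ x v) := by
  subst hx
  have hsource := (extChartAt (𝓡 2) x₀).map_target hy
  have halt : ∀ w : Euc 2, chartForm ρ.form x₀ y w w = 0 := fun w => ρ.alternating _ _
  have hform : chartForm ρ.form x₀ y (coframeAt x₀ _ ξ) v = ρ.form _ ξ (frameAt x₀ _ v) :=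
    congrArg (fun w => ρ.form _ w (frameAt x₀ _ v)) (frameAt_coframeAt hsource ξ)
  rw [← hform, alternating_apply halt, mul_comm]
  rfl

namespace IsChartPatch

variable {g : S → M} {x : S} {q : M} {U : Set (Euc 2)} {y : Euc 2}

lemma mfderiv_momentFn_frame (h : IsChartPatch g x₀ q U) (𝓗 : HyperKahler M) (ρ : AreaForm S)
    (hy : y ∈ U) (hx : (extChartAt (𝓡 2) x₀).symm y = x) (a : Fin 3) (v : Euc 2) :
    mfderiv (𝓡 2) 𝓘(ℝ, ℝ) (momentFn 𝓗 ρ g a) x (frameAt x₀ x v)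
      = fderiv ℝ (coordMoment (chartForm 𝓗.metric.inner q) (chartEnd (𝓗.cplx a) q)
        (coordArea ρ x₀) (coordMap g x₀ q)) y v := by
  subst hx
  refine mfderiv_frameAt_of_eventuallyEq (h.subset_target hy)
    ((h.isHyperkahlerPatch 𝓗 ρ).differentiableAt_coordMoment hy a) ?_ v
  filter_upwards [h.isOpen.mem_nhds hy] with z hz using h.momentFn_eq 𝓗 ρ hz rfl a

lemma coframeAt_cplx_mfderiv (h : IsChartPatch g x₀ q U) (𝓗 : HyperKahler M)
    (hy : y ∈ U) (hx : (extChartAt (𝓡 2) x₀).symm y = x) (a : Fin 3) (ξ : TangentSpace (𝓡 2) x) :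
    coframeAt q (g x) (𝓗.cplx a (g x) (mfderiv (𝓡 2) (𝓡 4) g x ξ))
      = chartEnd (𝓗.cplx a) q (coordMap g x₀ q y)
        (fderiv ℝ (coordMap g x₀ q) y (coframeAt x₀ x ξ)) := by
  have hframe := h.mfderiv_frame hy hx (coframeAt x₀ x ξ)
  rw [frameAt_coframeAt (h.mem_source hy hx)] at hframe
  subst hx
  rw [hframe]
  exact (chartEnd_apply (𝓗.cplx a) (h.mapsTo_source y hy) _).symm

end IsChartPatch

/-- Neighbourhoods of `t₀` in `τ` and of `x₀` in its chart on which `f` is smooth, consists of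
immersions and takes values in the chart at `f t₀ x₀`. -/
structure IsFlowChart (τ : Set ℝ) (f : ℝ → S → M) (t₀ : ℝ) (x₀ : S) (T : Set ℝ)
    (U : Set (Euc 2)) : Prop where
  subset : T ⊆ τ
  mem_nhdsWithin : T ∈ nhdsWithin t₀ τ
  mem_time : t₀ ∈ T
  convex : Convex ℝ T
  interior_nonempty : (interior T).Nonempty
  isChartPatch : ∀ s ∈ T, IsChartPatch (f s) x₀ (f t₀ x₀) U
  smooth : ContDiffOn ℝ ∞ (fun z : ℝ × Euc 2 => coordMap (f z.1) x₀ (f t₀ x₀) z.2) (T ×ˢ U)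

namespace IsHFlow

lemma contMDiff (hf : IsHFlow 𝓗 ρ τ f) (ht : t ∈ τ) : ContMDiff (𝓡 2) (𝓡 4) ∞ (f t) :=
  contMDiffOn_univ.1 <| hf.smooth.comp
    (contMDiff_const.prodMk contMDiff_id : ContMDiff (𝓡 2) (𝓘(ℝ, ℝ).prod (𝓡 2)) ∞
      fun x : S => (t, x)).contMDiffOn fun _ hx => ⟨ht, hx⟩

lemma contMDiffOn_chart_symm (hf : IsHFlow 𝓗 ρ τ f) (x₀ : S) :
    ContMDiffOn (𝓘(ℝ, ℝ).prod 𝓘(ℝ, Euc 2)) (𝓡 4) ∞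
      (fun z : ℝ × Euc 2 => f z.1 ((extChartAt (𝓡 2) x₀).symm z.2))
      (τ ×ˢ (extChartAt (𝓡 2) x₀).target) := by
  have hprod : ContMDiffOn (𝓘(ℝ, ℝ).prod 𝓘(ℝ, Euc 2)) (𝓘(ℝ, ℝ).prod (𝓡 2)) ∞
      (Prod.map (id : ℝ → ℝ) (extChartAt (𝓡 2) x₀).symm)
      (τ ×ˢ (extChartAt (𝓡 2) x₀).target) :=
    contMDiffOn_id.prodMap (contMDiffOn_extChartAt_symm x₀)
  exact hf.smooth.comp hprod fun z hz => ⟨hz.1, trivial⟩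

lemma exists_mapsTo_source (hf : IsHFlow 𝓗 ρ τ f) (ht₀ : t₀ ∈ τ) (x₀ : S) :
    ∃ ε > 0, ∃ δ > 0, ∀ s ∈ τ ∩ Metric.ball t₀ ε,
      ∀ y ∈ Metric.ball (extChartAt (𝓡 2) x₀ x₀) δ ∩ (extChartAt (𝓡 2) x₀).target,
        f s ((extChartAt (𝓡 2) x₀).symm y) ∈ (extChartAt (𝓡 4) (f t₀ x₀)).source := by
  have hcont := (hf.contMDiffOn_chart_symm x₀).continuousOn (t₀, extChartAt (𝓡 2) x₀ x₀)
    ⟨ht₀, mem_extChartAt_target x₀⟩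
  have hsource : (extChartAt (𝓡 4) (f t₀ x₀)).source
      ∈ nhds (f t₀ ((extChartAt (𝓡 2) x₀).symm (extChartAt (𝓡 2) x₀ x₀))) := by
    rw [extChartAt_to_inv]
    exact extChartAt_source_mem_nhds (f t₀ x₀)
  have hpreimage := hcont hsource
  rw [Filter.mem_map, nhdsWithin_prod_eq, Filter.mem_prod_iff] at hpreimage
  obtain ⟨times, htimes, points, hpoints, hsub⟩ := hpreimage
  obtain ⟨ε, hε, hball_times⟩ := Metric.mem_nhdsWithin_iff.1 htimes
  obtain ⟨δ, hδ, hball_points⟩ := Metric.mem_nhdsWithin_iff.1 hpoints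
  exact ⟨ε, hε, δ, hδ, fun s hs y hy =>
    hsub (mk_mem_prod (hball_times ⟨hs.2, hs.1⟩) (hball_points hy))⟩

lemma exists_isFlowChart (hf : IsHFlow 𝓗 ρ τ f) (hτ : τ.OrdConnected) (hτ' : τ.Nontrivial)
    (ht₀ : t₀ ∈ τ) (x₀ : S) : ∃ T U, IsFlowChart τ f t₀ x₀ T U := by
  obtain ⟨ε, hε, δ, hδ, hmaps⟩ := hf.exists_mapsTo_source ht₀ x₀
  refine ⟨τ ∩ Metric.ball t₀ ε,
    Metric.ball (extChartAt (𝓡 2) x₀ x₀) δ ∩ (extChartAt (𝓡 2) x₀).target, ?_⟩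
  exact
    { subset := inter_subset_left
      mem_nhdsWithin := Filter.inter_mem self_mem_nhdsWithin
        (mem_nhdsWithin_of_mem_nhds (Metric.ball_mem_nhds _ hε))
      mem_time := ⟨ht₀, Metric.mem_ball_self hε⟩
      convex := hτ.convex.inter (convex_ball t₀ ε)
      interior_nonempty := interior_inter_ball_nonempty hτ.convex
        (hτ.convex.nontrivial_iff_nonempty_interior.1 hτ') ht₀ hε
      isChartPatch := fun s hs =>
        { contMDiff := hf.contMDiff hs.1
          injective := hf.immersion s hs.1
          isOpen := Metric.isOpen_ball.inter (isOpen_extChartAt_target x₀)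
          mem_base := ⟨Metric.mem_ball_self hδ, mem_extChartAt_target x₀⟩
          subset_target := inter_subset_right
          mapsTo_source := hmaps s hs }
      smooth := by
        have hsmooth := (contMDiffOn_extChartAt (I := 𝓡 4) (n := ∞)).comp
          ((hf.contMDiffOn_chart_symm x₀).mono (prod_mono inter_subset_left inter_subset_right))
          fun z hz => (extChartAt_source (𝓡 4) (f t₀ x₀)).subset (hmaps z.1 hz.1 z.2 hz.2)
        rw [← modelWithCornersSelf_prod, chartedSpaceSelf_prod] at hsmooth
        exact contMDiffOn_iff_contDiffOn.1 hsmooth }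

end IsHFlow

lemma IsFlowChart.exists_velocity {T : Set ℝ} {U : Set (Euc 2)} {y : Euc 2}
    (h : IsFlowChart τ f t₀ x₀ T U) (hf : IsHFlow 𝓗 ρ τ f) (ht : t ∈ T) (hy : y ∈ U) :
    ∃ V, IsFlowVelocity (chartForm 𝓗.metric.inner (f t₀ x₀))
        (fun a => chartEnd (𝓗.cplx a) (f t₀ x₀)) (coordArea ρ x₀)
        (coordMap (f t) x₀ (f t₀ x₀)) y V
      ∧ HasDerivWithinAt (fun s => coordMap (f s) x₀ (f t₀ x₀) y) V T t := by
  obtain ⟨ξ, hξ, hflow⟩ := hf.flow t (h.subset ht) ((extChartAt (𝓡 2) x₀).symm y)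
  have hpatch := h.isChartPatch t ht
  refine ⟨_, ⟨fun a => coframeAt x₀ _ (ξ a), fun a v => ?_, rfl⟩, ?_⟩
  · rw [coordArea_mul_wedge ρ (hpatch.subset_target hy) rfl, hξ,
      hpatch.mfderiv_momentFn_frame 𝓗 ρ hy rfl]
  · refine (hasDerivWithinAt_extChartAt_comp (hflow.mono h.subset)
      (hpatch.mapsTo_source y hy)).congr_deriv ?_
    rw [map_sum]
    exact Finset.sum_congr rfl fun a _ => hpatch.coframeAt_cplx_mfderiv 𝓗 hy rfl a (ξ a)

end Flow

/-! ### Evolution equations -/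

section Function

variable {n : ℕ} {N : Type*} [TopologicalSpace N] [ChartedSpace (Euc n) N] [IsManifold (𝓡 n) ∞ N]
  (g : ∀ x : N, TangentSpace (𝓡 n) x →L[ℝ] TangentSpace (𝓡 n) x →L[ℝ] ℝ)

lemma hess_const_mul (c : ℝ) (u : N → ℝ) (x : N) (v w : Euc n) :
    hess g (fun y => c * u y) x v w = c * hess g u x v w := by
  change fderiv ℝ (fderiv ℝ (c • (u ∘ (extChartAt (𝓡 n) x).symm))) _ v w
    - fderiv ℝ (c • (u ∘ (extChartAt (𝓡 n) x).symm)) _ _ = _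
  have hsnd (φ : Euc n → Euc n →L[ℝ] ℝ) : fderiv ℝ (c • φ) = c • fderiv ℝ φ :=
    fderiv_const_smul_field (F := Euc n →L[ℝ] ℝ) c
  rw [fderiv_const_smul_field, hsnd, hess, Pi.smul_apply, smul_apply,
    smul_apply, Pi.smul_apply, smul_apply, smul_eq_mul, smul_eq_mul, mul_sub]

lemma laplacian_const_mul (c : ℝ) (u : N → ℝ) (x : N) :
    laplacian g (fun y => c * u y) x = c * laplacian g u x := by
  have hhess : hess g (fun y => c * u y) x = fun v w => c * hess g u x v w :=
    funext₂ (hess_const_mul g c u x)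
  rw [laplacian, hhess]
  exact (map_metricTrace (LinearMap.mulLeft ℝ c) (g x) (hess g u x)).symm

end Function

section Evolution

variable {S M : Type*} [TopologicalSpace S] [ChartedSpace (Euc 2) S]
  [TopologicalSpace M] [ChartedSpace (Euc 4) M] [IsManifold (𝓡 4) ∞ M]
  {x : S}

lemma inner_secondFF (𝓗 : HyperKahler M) {g : S → M}
    (hg : Function.Injective (mfderiv (𝓡 2) (𝓡 4) g x)) (v w z : Euc 2) :
    𝓗.metric.inner (g x) (mfderiv (𝓡 2) (𝓡 4) g x z) (secondFF 𝓗 g x v w) = 0 := by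
  rw [𝓗.metric.symm]
  exact (𝓗.isInner (g x)).inner_normalProj hg (covDerivAlong 𝓗 g x v w) z

lemma meanCurvSq_eq (𝓗 : HyperKahler M) (g : S → M) (x : S) :
    meanCurvSq 𝓗 g x = metricTrace (inducedMetric 𝓗 g x) fun v w =>
      𝓗.metric.inner (g x) (meanCurv 𝓗 g x) (secondFF 𝓗 g x v w) :=
  map_metricTrace (𝓗.metric.inner (g x) (meanCurv 𝓗 g x)).toLinearMap (inducedMetric 𝓗 g x)
    fun v w => secondFF 𝓗 g x v w

lemma meanCurvSq_nonneg (𝓗 : HyperKahler M) (g : S → M) (x : S) : 0 ≤ meanCurvSq 𝓗 g x :=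
  (𝓗.isInner (g x)).nonneg (meanCurv 𝓗 g x)

variable [IsManifold (𝓡 2) ∞ S] {𝓗 : HyperKahler M} {ρ : AreaForm S} {τ : Set ℝ}
  {f : ℝ → S → M} {t₀ t : ℝ} {x₀ : S}

namespace IsFlowChart

variable {T : Set ℝ} {U : Set (Euc 2)}

lemma metric_variation (h : IsFlowChart τ f t₀ x₀ T U) (𝓗 : HyperKahler M) (ρ : AreaForm S)
    {V : Euc 2 → Euc 4}
    (hVd : DifferentiableAt ℝ V (extChartAt (𝓡 2) x₀ x₀))
    (hV : ∀ y ∈ U, IsFlowVelocity (chartForm 𝓗.metric.inner (f t₀ x₀))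
      (fun a => chartEnd (𝓗.cplx a) (f t₀ x₀)) (coordArea ρ x₀)
      (coordMap (f t₀) x₀ (f t₀ x₀)) y (V y)) (v w : Euc 2) :
    letI y := extChartAt (𝓡 2) x₀ x₀
    letI G := chartForm 𝓗.metric.inner (f t₀ x₀)
    letI F := coordMap (f t₀) x₀ (f t₀ x₀)
    fderiv ℝ G (F y) (V y) (fderiv ℝ F y v) (fderiv ℝ F y w)
        + G (F y) (fderiv ℝ V y v) (fderiv ℝ F y w) + G (F y) (fderiv ℝ F y v) (fderiv ℝ V y w)
      = hess (inducedMetric 𝓗 (f t₀)) (fun x => lam 𝓗 ρ (f t₀) x ^ 2) x₀ v w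
        - 2 * lam 𝓗 ρ (f t₀) x₀ ^ 2 *
          𝓗.metric.inner (f t₀ x₀) (meanCurv 𝓗 (f t₀) x₀) (secondFF 𝓗 (f t₀) x₀ v w) := by
  have hpatch := h.isChartPatch t₀ h.mem_time
  rw [hpatch.hess_lam_sq 𝓗 ρ, hpatch.lam_sq 𝓗 ρ hpatch.mem_base (extChartAt_to_inv x₀),
    hpatch.meanCurv_eq 𝓗, hpatch.secondFF_eq 𝓗, ← 𝓗.metric_base (f t₀) x₀]
  refine (hpatch.isHyperkahlerPatch 𝓗 ρ).metric_variation hpatch.mem_base ?_ (fun a => ?_)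
    (hpatch.isLeviCivitaAt_inducedMetric 𝓗) hVd hV v w
  · rw [coordMap_base]
    exact isLeviCivitaAt_christoffel (𝓗.isInner _)
  · rw [coordMap_base]
    exact 𝓗.isParallelAt a (f t₀ x₀)

lemma hasDerivWithinAt_inducedMetric (h : IsFlowChart τ f t₀ x₀ T U) (hf : IsHFlow 𝓗 ρ τ f)
    (v w : Euc 2) :
    HasDerivWithinAt (fun s => inducedMetric 𝓗 (f s) x₀ v w)
      (hess (inducedMetric 𝓗 (f t₀)) (fun y => lam 𝓗 ρ (f t₀) y ^ 2) x₀ v w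
        - 2 * lam 𝓗 ρ (f t₀) x₀ ^ 2 *
          𝓗.metric.inner (f t₀ x₀) (meanCurv 𝓗 (f t₀) x₀) (secondFF 𝓗 (f t₀) x₀ v w)) τ t₀ := by
  have hpatch := h.isChartPatch t₀ h.mem_time
  choose! V hV using fun y hy => h.exists_velocity hf h.mem_time hy (y := y)
  have hslice := hasDerivWithinAt_fderiv_slice h.convex h.interior_nonempty hpatch.isOpen
    h.smooth h.mem_time (fun y hy => (hV y hy).2) hpatch.mem_base
  have hmetric : DifferentiableAt ℝ (chartForm 𝓗.metric.inner (f t₀ x₀))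
      (coordMap (f t₀) x₀ (f t₀ x₀) (extChartAt (𝓡 2) x₀ x₀)) :=
    ((hpatch.isImmersedPatch 𝓗).isMetricOn).differentiableAt
      ((hpatch.isImmersedPatch 𝓗).mapsTo hpatch.mem_base)
  have hderiv := hasDerivWithinAt_bilin_comp hmetric (hV _ hpatch.mem_base).2 (hslice v).2
    (hslice w).2
  have hcongr : ∀ s ∈ T, inducedMetric 𝓗 (f s) x₀ v w
      = coordMetric (chartForm 𝓗.metric.inner (f t₀ x₀)) (coordMap (f s) x₀ (f t₀ x₀))
        (extChartAt (𝓡 2) x₀ x₀) v w := fun s hs => by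
    rw [(h.isChartPatch s hs).inducedMetric_base 𝓗]
    rfl
  rw [← h.metric_variation 𝓗 ρ (hslice 0).1 (fun y hy => (hV y hy).1) v w]
  exact (hderiv.congr hcongr (hcongr t₀ h.mem_time)).mono_of_mem_nhdsWithin h.mem_nhdsWithin

lemma laplacian_lam_sq_nonpos (h : IsFlowChart τ f t₀ x₀ T U) (𝓗 : HyperKahler M) (ρ : AreaForm S)
    (hmax : ∀ y, lam 𝓗 ρ (f t₀) y ^ 2 ≤ lam 𝓗 ρ (f t₀) x₀ ^ 2) :
    laplacian (inducedMetric 𝓗 (f t₀)) (fun y => lam 𝓗 ρ (f t₀) y ^ 2) x₀ ≤ 0 := by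
  have hpatch := h.isChartPatch t₀ h.mem_time
  set u := coordLamSq (chartForm 𝓗.metric.inner (f t₀ x₀)) (coordArea ρ x₀)
    (coordMap (f t₀) x₀ (f t₀ x₀)) with hu
  have hlocal : IsLocalMax u (extChartAt (𝓡 2) x₀ x₀) := by
    filter_upwards [hpatch.mem_nhds] with y hy
    rw [hu, ← hpatch.lam_sq 𝓗 ρ hy rfl,
      ← hpatch.lam_sq 𝓗 ρ hpatch.mem_base (extChartAt_to_inv x₀)]
    exact hmax _
  have hsmooth : ContDiffAt ℝ 2 u (extChartAt (𝓡 2) x₀ x₀) :=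
    ((hpatch.isHyperkahlerPatch 𝓗 ρ).coordLamSq_smooth.contDiffAt hpatch.mem_nhds).of_le
      ENat.LEInfty.out
  have hhess : hess (inducedMetric 𝓗 (f t₀)) (fun y => lam 𝓗 ρ (f t₀) y ^ 2) x₀
      = fun v w => fderiv ℝ (fderiv ℝ u) (extChartAt (𝓡 2) x₀ x₀) v w := by
    funext v w
    rw [hpatch.hess_lam_sq 𝓗 ρ, ← hu, hlocal.fderiv_eq_zero, zero_apply, sub_zero]
  rw [laplacian, hhess]
  exact (isInner_inducedMetric 𝓗 (hpatch.injective x₀)).metricTrace_nonpos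
    (fderiv_fderiv_nonpos_of_isLocalMax hsmooth hlocal)

lemma continuousOn_coordLamSq (h : IsFlowChart τ f t₀ x₀ T U) (𝓗 : HyperKahler M)
    (ρ : AreaForm S) :
    ContinuousOn (fun z : ℝ × Euc 2 => coordLamSq (chartForm 𝓗.metric.inner (f t₀ x₀))
      (coordArea ρ x₀) (coordMap (f z.1) x₀ (f t₀ x₀)) z.2) (T ×ˢ U) := by
  have hpatch := (h.isChartPatch t₀ h.mem_time).isHyperkahlerPatch 𝓗 ρ
  have hG : ContinuousOn (fun z : ℝ × Euc 2 => chartForm 𝓗.metric.inner (f t₀ x₀)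
      (coordMap (f z.1) x₀ (f t₀ x₀) z.2)) (T ×ˢ U) :=
    hpatch.isMetricOn.smooth.continuousOn.comp h.smooth.continuousOn
      fun z hz => ((h.isChartPatch z.1 hz.1).isImmersedPatch 𝓗).mapsTo hz.2
  have hD (v : Euc 2) : ContinuousOn (fun z : ℝ × Euc 2 =>
      fderiv ℝ (coordMap (f z.1) x₀ (f t₀ x₀)) z.2 v) (T ×ˢ U) :=
    (continuousOn_fderiv_slice (uniqueDiffOn_convex h.convex h.interior_nonempty)
      hpatch.isOpen h.smooth).clm_apply continuousOn_const
  have hr : ContinuousOn (fun z : ℝ × Euc 2 => coordArea ρ x₀ z.2) (T ×ˢ U) :=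
    hpatch.area_smooth.continuousOn.comp continuousOn_snd fun z hz => hz.2
  have hg (v w : Euc 2) : ContinuousOn (fun z : ℝ × Euc 2 =>
      coordMetric (chartForm 𝓗.metric.inner (f t₀ x₀)) (coordMap (f z.1) x₀ (f t₀ x₀)) z.2 v w)
      (T ×ˢ U) := (hG.clm_apply (hD v)).clm_apply (hD w)
  simp only [coordLamSq, Matrix.det_fin_two, gram, Matrix.of_apply]
  exact (((hg _ _).mul (hg _ _)).sub ((hg _ _).mul (hg _ _))).div (hr.pow 2)
    fun z hz => pow_ne_zero 2 (hpatch.area_ne_zero _ hz.2)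

end IsFlowChart

namespace IsHFlow

lemma hasDerivWithinAt_metric (hf : IsHFlow 𝓗 ρ τ f) (hτ : τ.OrdConnected)
    (hτ' : τ.Nontrivial) (ht : t ∈ τ) (v w : Euc 2)
    (e : Fin 2 → TangentSpace (𝓡 4) (f t x)) (he : IsNormalFrame 𝓗 (f t) x e) :
    HasDerivWithinAt (fun s => inducedMetric 𝓗 (f s) x v w)
      (hess (inducedMetric 𝓗 (f t)) (fun y => lam 𝓗 ρ (f t) y ^ 2) x v w
        - 2 * lam 𝓗 ρ (f t) x ^ 2 *
          ∑ α, 𝓗.metric.inner (f t x) (e α) (meanCurv 𝓗 (f t) x) *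
            𝓗.metric.inner (f t x) (e α) (secondFF 𝓗 (f t) x v w)) τ t := by
  obtain ⟨T, U, h⟩ := hf.exists_isFlowChart hτ hτ' ht x
  have hframe : ∑ α, 𝓗.metric.inner (f t x) (e α) (meanCurv 𝓗 (f t) x) *
      𝓗.metric.inner (f t x) (e α) (secondFF 𝓗 (f t) x v w)
      = 𝓗.metric.inner (f t x) (meanCurv 𝓗 (f t) x) (secondFF 𝓗 (f t) x v w) := by
    rw [𝓗.metric.symm (f t x) (meanCurv 𝓗 (f t) x)]
    exact (Finset.sum_congr rfl fun α _ => mul_comm _ _).trans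
      ((𝓗.isInner (f t x)).sum_inner_normalFrame (hf.immersion t ht x) rfl he.1 he.2
        (inner_secondFF 𝓗 (hf.immersion t ht x) v w) (meanCurv 𝓗 (f t) x))
  exact (h.hasDerivWithinAt_inducedMetric hf v w).congr_deriv (congrArg (fun a : ℝ =>
    hess (inducedMetric 𝓗 (f t)) (fun y => lam 𝓗 ρ (f t) y ^ 2) x v w
      - 2 * lam 𝓗 ρ (f t) x ^ 2 * a) hframe.symm)

lemma hasDerivWithinAt_det_gram_inducedMetric (hf : IsHFlow 𝓗 ρ τ f) (hτ : τ.OrdConnected)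
    (hτ' : τ.Nontrivial) (ht : t ∈ τ) :
    HasDerivWithinAt (fun s => (gram (inducedMetric 𝓗 (f s) x)).det)
      ((gram (inducedMetric 𝓗 (f t) x)).det *
        (laplacian (inducedMetric 𝓗 (f t)) (fun y => lam 𝓗 ρ (f t) y ^ 2) x
          - 2 * lam 𝓗 ρ (f t) x ^ 2 * meanCurvSq 𝓗 (f t) x)) τ t := by
  obtain ⟨T, U, h⟩ := hf.exists_isFlowChart hτ hτ' ht x
  refine (hasDerivWithinAt_det_gram (B := fun s => inducedMetric 𝓗 (f s) x)
    (isInner_inducedMetric 𝓗 (hf.immersion t ht x))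
    (h.hasDerivWithinAt_inducedMetric hf)).congr_deriv (congrArg _ ?_)
  simp only [laplacian, meanCurvSq_eq, metricTrace, smul_eq_mul, mul_sub, Finset.mul_sum,
    Finset.sum_sub_distrib, mul_left_comm]

lemma hasDerivWithinAt_area (hf : IsHFlow 𝓗 ρ τ f) (hτ : τ.OrdConnected)
    (hτ' : τ.Nontrivial) (ht : t ∈ τ) (v w : Euc 2) :
    HasDerivWithinAt (fun s => inducedArea 𝓗 ρ (f s) x v w)
      ((laplacian (inducedMetric 𝓗 (f t)) (fun y => lam 𝓗 ρ (f t) y ^ 2 / 2) x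
        - lam 𝓗 ρ (f t) x ^ 2 * meanCurvSq 𝓗 (f t) x)
        * inducedArea 𝓗 ρ (f t) x v w) τ t := by
  have hpos := (isInner_inducedMetric 𝓗 (hf.immersion t ht x)).det_gram_pos
  have harea := fun s (hs : s ∈ τ) => inducedArea_eq 𝓗 ρ (hf.immersion s hs x) v w
  have hsqrt := ((hf.hasDerivWithinAt_det_gram_inducedMetric hτ hτ' ht (x := x)).sqrt
    hpos.ne').const_mul (SignType.sign (ρ.form x (basisVec 2 0) (basisVec 2 1)) : ℝ)
  refine ((hsqrt.const_mul (wedge v w)).congr harea (harea t ht)).congr_deriv ?_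
  have hhalf : (fun y => lam 𝓗 ρ (f t) y ^ 2 / 2) = fun y => 1 / 2 * lam 𝓗 ρ (f t) y ^ 2 :=
    funext fun y => by rw [one_div_mul_eq_div]
  rw [harea t ht, hhalf, laplacian_const_mul]
  have hsq := Real.sq_sqrt hpos.le
  have hne := (Real.sqrt_pos.2 hpos).ne'
  generalize √(gram (inducedMetric 𝓗 (f t) x)).det = σ at *
  rw [← hsq]
  field_simp

lemma hasDerivWithinAt_lam_sq (hf : IsHFlow 𝓗 ρ τ f) (hτ : τ.OrdConnected)
    (hτ' : τ.Nontrivial) (ht : t ∈ τ) :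
    HasDerivWithinAt (fun s => lam 𝓗 ρ (f s) x ^ 2)
      (lam 𝓗 ρ (f t) x ^ 2 * laplacian (inducedMetric 𝓗 (f t)) (fun y => lam 𝓗 ρ (f t) y ^ 2) x
        - 2 * (lam 𝓗 ρ (f t) x ^ 2) ^ 2 * meanCurvSq 𝓗 (f t) x) τ t := by
  have hlam := fun s (hs : s ∈ τ) => lam_sq_eq 𝓗 ρ (hf.immersion s hs x)
  refine (((hf.hasDerivWithinAt_det_gram_inducedMetric hτ hτ' ht).div_const _).congr hlam
    (hlam t ht)).congr_deriv ?_
  rw [mul_div_right_comm, ← hlam t ht]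
  ring

/-! ### The maximum principle -/

lemma continuousOn_lam_sq (hf : IsHFlow 𝓗 ρ τ f) (hτ : τ.OrdConnected) (hτ' : τ.Nontrivial) :
    ContinuousOn (fun z : ℝ × S => lam 𝓗 ρ (f z.1) z.2 ^ 2) (τ ×ˢ univ) := by
  rintro ⟨t, x⟩ ⟨ht, -⟩
  obtain ⟨T, U, h⟩ := hf.exists_isFlowChart hτ hτ' ht x
  have hpatch := h.isChartPatch t h.mem_time
  set O : Set S := (extChartAt (𝓡 2) x).source ∩ extChartAt (𝓡 2) x ⁻¹' U
  have hO : O ∈ nhds x := Filter.inter_mem (extChartAt_source_mem_nhds x)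
    ((continuousAt_extChartAt x).preimage_mem_nhds hpatch.mem_nhds)
  have hTO : T ×ˢ O ∈ nhdsWithin (t, x) (τ ×ˢ univ) := by
    rw [nhdsWithin_prod_eq, nhdsWithin_univ]
    exact Filter.prod_mem_prod h.mem_nhdsWithin hO
  have hchart : ContinuousOn (fun z : ℝ × S => (z.1, extChartAt (𝓡 2) x z.2)) (T ×ˢ O) :=
    continuousOn_fst.prodMk ((continuousOn_extChartAt x).comp continuousOn_snd
      fun z hz => hz.2.1)
  have hcoord := (h.continuousOn_coordLamSq 𝓗 ρ).comp hchart fun z hz => ⟨hz.1, hz.2.2⟩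
  have hlam : ContinuousOn (fun z : ℝ × S => lam 𝓗 ρ (f z.1) z.2 ^ 2) (T ×ˢ O) := by
    refine hcoord.congr fun z hz => ?_
    exact (h.isChartPatch z.1 hz.1).lam_sq 𝓗 ρ hz.2.2 ((extChartAt (𝓡 2) x).left_inv hz.2.1)
  exact (hlam (t, x) ⟨h.mem_time, mem_of_mem_nhds hO⟩).mono_of_mem_nhdsWithin hTO

lemma bddAbove_range_lam [CompactSpace S] (hf : IsHFlow 𝓗 ρ τ f) (hτ : τ.OrdConnected)
    (hτ' : τ.Nontrivial) (ht : t ∈ τ) : BddAbove (range (lam 𝓗 ρ (f t))) := by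
  have hcont : Continuous fun x => lam 𝓗 ρ (f t) x ^ 2 :=
    (hf.continuousOn_lam_sq hτ hτ').comp_continuous (f := fun x : S => (t, x))
      (Continuous.prodMk_right t) fun _ => ⟨ht, trivial⟩
  obtain ⟨C, hC⟩ := (isCompact_range hcont).bddAbove
  refine ⟨√C, ?_⟩
  rintro _ ⟨y, rfl⟩
  exact Real.le_sqrt_of_sq_le (hC ⟨y, rfl⟩)

lemma exists_hasDerivWithinAt_nonpos_of_isMax (hf : IsHFlow 𝓗 ρ τ f) (hτ : τ.OrdConnected)
    (hτ' : τ.Nontrivial) (ht : t ∈ τ) (hmax : ∀ y, lam 𝓗 ρ (f t) y ^ 2 ≤ lam 𝓗 ρ (f t) x ^ 2) :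
    ∃ r ≤ 0, HasDerivWithinAt (fun s => lam 𝓗 ρ (f s) x ^ 2) r τ t := by
  obtain ⟨T, U, h⟩ := hf.exists_isFlowChart hτ hτ' ht x
  refine ⟨_, sub_nonpos.2 ?_, hf.hasDerivWithinAt_lam_sq hτ hτ' ht⟩
  calc lam 𝓗 ρ (f t) x ^ 2 *
        laplacian (inducedMetric 𝓗 (f t)) (fun y => lam 𝓗 ρ (f t) y ^ 2) x
      ≤ 0 := mul_nonpos_of_nonneg_of_nonpos (sq_nonneg _) (h.laplacian_lam_sq_nonpos 𝓗 ρ hmax)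
    _ ≤ 2 * (lam 𝓗 ρ (f t) x ^ 2) ^ 2 * meanCurvSq 𝓗 (f t) x :=
      mul_nonneg (by positivity) (meanCurvSq_nonneg 𝓗 (f t) x)

lemma lam_le_iSup [CompactSpace S] (hf : IsHFlow 𝓗 ρ τ f) (hτ : τ.OrdConnected)
    (hτ' : τ.Nontrivial) (h0 : IsLeast τ 0) (ht : t ∈ τ) (x : S) :
    lam 𝓗 ρ (f t) x ≤ ⨆ y : S, lam 𝓗 ρ (f 0) y := by
  have hsub : Icc 0 t ⊆ τ := hτ.out h0.1 ht
  have hsup (y : S) : lam 𝓗 ρ (f 0) y ≤ ⨆ y : S, lam 𝓗 ρ (f 0) y :=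
    le_ciSup (hf.bddAbove_range_lam hτ hτ' h0.1) y
  have hnonneg (y : S) : 0 ≤ lam 𝓗 ρ (f 0) y := lam_nonneg 𝓗 ρ (hf.immersion 0 h0.1 y)
  have hsq : lam 𝓗 ρ (f t) x ^ 2 ≤ (⨆ y : S, lam 𝓗 ρ (f 0) y) ^ 2 := by
    refine le_of_hasDerivWithinAt_nonpos_of_isMax (u := fun s y => lam 𝓗 ρ (f s) y ^ 2) (h0.2 ht)
      ((hf.continuousOn_lam_sq hτ hτ').mono (prod_mono_left hsub)) (fun s hs y hmax => ?_)
      (fun y => pow_le_pow_left₀ (hnonneg y) (hsup y) 2) x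
    obtain ⟨r, hr, hderiv⟩ :=
      hf.exists_hasDerivWithinAt_nonpos_of_isMax hτ hτ' (hsub ⟨hs.1.le, hs.2⟩) hmax
    exact ⟨r, hr, hderiv.mono ((Icc_subset_Icc_right hs.2).trans hsub)⟩
  exact le_of_sq_le_sq hsq ((hnonneg x).trans (hsup x))

end IsHFlow

end Evolution

end HFlow

end

theorem proposition2p3
    {S M : Type*} [TopologicalSpace S] [T2Space S] [ChartedSpace (HFlow.Euc 2) S]
    [IsManifold (𝓡 2) ∞ S]
    [TopologicalSpace M] [T2Space M] [ChartedSpace (HFlow.Euc 4) M] [IsManifold (𝓡 4) ∞ M]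
    (𝓗 : HFlow.HyperKahler M) (ρ : HFlow.AreaForm S)
    (τ : Set ℝ) (hτ : τ.OrdConnected) (hτ' : τ.Nontrivial) (h0 : IsLeast τ 0)
    (f : ℝ → S → M) (hf : HFlow.IsHFlow 𝓗 ρ τ f) :
    -- evolution of the metric, area form and `λ²`
    (∀ t ∈ τ, ∀ x : S,
      (∀ (X Y : TangentSpace (𝓡 2) x) (e : Fin 2 → TangentSpace (𝓡 4) (f t x)),
        HFlow.IsNormalFrame 𝓗 (f t) x e →
        HasDerivWithinAt (fun s => HFlow.inducedMetric 𝓗 (f s) x X Y)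
          (HFlow.hess (HFlow.inducedMetric 𝓗 (f t)) (fun y => HFlow.lam 𝓗 ρ (f t) y ^ 2) x X Y
            - 2 * HFlow.lam 𝓗 ρ (f t) x ^ 2 *
              ∑ α, 𝓗.metric.inner (f t x) (e α) (HFlow.meanCurv 𝓗 (f t) x) *
                𝓗.metric.inner (f t x) (e α) (HFlow.secondFF 𝓗 (f t) x X Y))
          τ t) ∧
      (∀ X Y : TangentSpace (𝓡 2) x,
        HasDerivWithinAt (fun s => HFlow.inducedArea 𝓗 ρ (f s) x X Y)
          ((HFlow.laplacian (HFlow.inducedMetric 𝓗 (f t))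
              (fun y => HFlow.lam 𝓗 ρ (f t) y ^ 2 / 2) x
            - HFlow.lam 𝓗 ρ (f t) x ^ 2 * HFlow.meanCurvSq 𝓗 (f t) x)
            * HFlow.inducedArea 𝓗 ρ (f t) x X Y)
          τ t) ∧
      HasDerivWithinAt (fun s => HFlow.lam 𝓗 ρ (f s) x ^ 2)
        (HFlow.lam 𝓗 ρ (f t) x ^ 2 *
            HFlow.laplacian (HFlow.inducedMetric 𝓗 (f t)) (fun y => HFlow.lam 𝓗 ρ (f t) y ^ 2) x
          - 2 * (HFlow.lam 𝓗 ρ (f t) x ^ 2) ^ 2 * HFlow.meanCurvSq 𝓗 (f t) x)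
        τ t) ∧
    -- the maximum principle bound
    (CompactSpace S → ∀ t ∈ τ, ∀ x : S,
      HFlow.lam 𝓗 ρ (f t) x ≤ ⨆ y : S, HFlow.lam 𝓗 ρ (f 0) y) := by
  refine ⟨fun t ht x => ⟨fun X Y e he => hf.hasDerivWithinAt_metric hτ hτ' ht X Y e he,
    hf.hasDerivWithinAt_area hτ hτ' ht, hf.hasDerivWithinAt_lam_sq hτ hτ' ht⟩, ?_⟩
  intro hS t ht x
  exact hf.lam_le_iSup hτ hτ' h0 ht x
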